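/- **Theorem 2.1 (Energy bounds).** Let $V\ge 0$ be an external potential on the unit interval that is the sum of a nonnegative locally integrable function on $(0,1)$ and of at most countably many delta functions at points of $(0,1)$ with nonnegative strengths, the total strength of the delta functions in each compact subset of $(0,1)$ being finite. Let $\gamma\ge 0$. For $N\ge 1$ let $E_0^{\rm QM}$ be the ground state energy (the infimum of the expectation values over normalized permutation symmetric wave functions in the form domain) of the Hamiltonian $$H=\sum_{i=1}^N\left(-\partial_{z_i}^2+V(z_i)\right)+\frac{\gamma}{N}\sum_{i<j}\delta(z_i-z_j)$$ on the symmetric subspace of $L^2([0,1]^N)$, with Dirichlet boundary conditions. Then the Gross–Pitaevskii functional $$\mathcal E^{\rm GP}[\psi]=\int_0^1\left\{|\psi'(z)|^2+V(z)|\psi(z)|^2+\tfrac{\gamma}{2}|\psi(z)|^4\right\}dz$$ has a nonnegative minimizer $\psi_0$ among all $\psi\in H_0^1([0,1])$ with $\int_0^1|\psi|^2=1$. Let $e_0$ be the ground state energy of the mean-field Hamiltonian $$h=-\partial_z^2+V(z)+\gamma\,\psi_0(z)^2-\frac{\gamma}{2}\int_0^1\psi_0^4$$ on $L^2([0,1])$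 with Dirichlet boundary conditions, for any such $\psi_0$. Then $e_0$ equals the minimum of $\mathcal E^{\rm GP}$ over all such $\psi$, and $$e_0\;\ge\;\frac{E_0^{\rm QM}}{N}\;\ge\; e_0\left(1-C\,N^{-1/3}\min\{\gamma^{1/2},\gamma\}\right),$$ where $C>0$ is a universal constant; in particular $C$ does not depend on $N$, $\gamma$ or $V$. -/

import Mathlib

open MeasureTheory Set

namespace LiebLiniger

/-- A nonnegative external potential on the unit interval: the sum of a nonnegative function that is
locally integrable on `(0,1)` and of (at most countably many) delta functions `strength k • δ_{site k}`
with nonnegative strengths, whose total strength on every compact subset of `(0,1)` is finite.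
(Finitely many deltas: put `strength k = 0` for all other `k`.) -/
structure Potential where
  /-- the locally integrable part -/
  density : ℝ → ℝ
  density_nonneg : ∀ x ∈ Ioo (0 : ℝ) 1, 0 ≤ density x
  density_locallyIntegrable : LocallyIntegrableOn density (Ioo (0 : ℝ) 1)
  /-- the positions of the delta functions -/
  site : ℕ → ℝ
  site_mem : ∀ k, site k ∈ Ioo (0 : ℝ) 1
  /-- the strengths of the delta functions -/
  strength : ℕ → NNReal
  strength_locallyFinite : ∀ K : Set ℝ, IsCompact K → K ⊆ Ioo (0 : ℝ) 1 →
    (Measure.sum fun k => strength k • Measure.dirac (site k)) K < ⊤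

/-- The potential, viewed as the Borel measure `V(x) dx` on `(0,1)`. -/
noncomputable def Potential.measure (V : Potential) : Measure ℝ :=
  (volume.restrict (Ioo (0 : ℝ) 1)).withDensity (fun x => ENNReal.ofReal (V.density x)) +
    Measure.sum fun k => V.strength k • Measure.dirac (V.site k)

/-! ### One particle -/

/-- `ψ ∈ H₀¹([0,1])` with weak derivative `dψ`: `dψ` is square integrable, `ψ` is the primitive of
`dψ` that vanishes at `0`, and `ψ` vanishes at `1`. -/
structure IsH01 (ψ dψ : ℝ → ℂ) : Prop where
  memLp : MemLp dψ 2 (volume.restrict (Icc (0 : ℝ) 1))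
  eq_integral : ∀ x ∈ Icc (0 : ℝ) 1, ψ x = ∫ t in (0 : ℝ)..x, dψ t
  right_eq_zero : ψ 1 = 0

/-- The normalized elements of the form domain `{ψ ∈ H₀¹([0,1]) : ∫ V|ψ|² < ∞}`. -/
structure IsAdmissible (V : Potential) (ψ dψ : ℝ → ℂ) : Prop where
  isH01 : IsH01 ψ dψ
  integrable_potential : Integrable (fun x => ‖ψ x‖ ^ 2) V.measure
  normalized : ∫ x in Icc (0 : ℝ) 1, ‖ψ x‖ ^ 2 = 1

/-- The Gross-Pitaevskii functional `∫₀¹ (|ψ'|² + V|ψ|² + (γ/2)|ψ|⁴)`. -/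
noncomputable def gpFunctional (V : Potential) (γ : ℝ) (ψ dψ : ℝ → ℂ) : ℝ :=
  (∫ x in Icc (0 : ℝ) 1, ‖dψ x‖ ^ 2) + (∫ x, ‖ψ x‖ ^ 2 ∂V.measure)
    + γ / 2 * ∫ x in Icc (0 : ℝ) 1, ‖ψ x‖ ^ 4

/-- The Gross-Pitaevskii energy. -/
noncomputable def gpEnergy (V : Potential) (γ : ℝ) : ℝ :=
  sInf {E : ℝ | ∃ ψ dψ : ℝ → ℂ, IsAdmissible V ψ dψ ∧ E = gpFunctional V γ ψ dψ}

/-- `ψ₀` is a nonnegative normalized minimizer of the Gross-Pitaevskii functional. -/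
def IsGPMinimizer (V : Potential) (γ : ℝ) (ψ₀ : ℝ → ℝ) : Prop :=
  (∀ x ∈ Icc (0 : ℝ) 1, 0 ≤ ψ₀ x) ∧
  ∃ dψ₀ : ℝ → ℂ, IsAdmissible V (fun x => (ψ₀ x : ℂ)) dψ₀ ∧
    ∀ φ dφ : ℝ → ℂ, IsAdmissible V φ dφ →
      gpFunctional V γ (fun x => (ψ₀ x : ℂ)) dψ₀ ≤ gpFunctional V γ φ dφ

/-- The expectation value `⟨φ, h φ⟩` of the mean-field Hamiltonian
`h = -∂² + V + γ ψ₀² - (γ/2) ∫ ψ₀⁴` (for `φ` in the form domain). -/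
noncomputable def meanFieldForm (V : Potential) (γ : ℝ) (ψ₀ : ℝ → ℝ) (φ dφ : ℝ → ℂ) : ℝ :=
  (∫ x in Icc (0 : ℝ) 1, ‖dφ x‖ ^ 2) + (∫ x, ‖φ x‖ ^ 2 ∂V.measure)
    + γ * (∫ x in Icc (0 : ℝ) 1, ψ₀ x ^ 2 * ‖φ x‖ ^ 2)
    - γ / 2 * (∫ x in Icc (0 : ℝ) 1, ψ₀ x ^ 4) * ∫ x in Icc (0 : ℝ) 1, ‖φ x‖ ^ 2

/-- The ground state energy of the mean-field Hamiltonian `h` with Dirichlet boundary conditions: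
the infimum of `⟨φ, h φ⟩` over all normalized `φ` in the form domain. -/
noncomputable def meanFieldEnergy (V : Potential) (γ : ℝ) (ψ₀ : ℝ → ℝ) : ℝ :=
  sInf {E : ℝ | ∃ φ dφ : ℝ → ℂ, IsAdmissible V φ dφ ∧ E = meanFieldForm V γ ψ₀ φ dφ}

/-! ### `N` particles -/

/-- Lebesgue measure on the cube `[0,1]^N`. -/
noncomputable def cube (N : ℕ) : Measure (Fin N → ℝ) :=
  volume.restrict (Icc (0 : Fin N → ℝ) 1)

/-- For `Ψ ∈ H₀¹([0,1]^N)` with gradient `G`, the value of `Ψ` at the point that arises from `z` when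
the `i`-th coordinate is replaced by `t`, computed as the line integral of `∂ᵢΨ` from the face
`zᵢ = 0`. For almost every choice of the other coordinates this is the representative of `Ψ` that is
(absolutely) continuous in the `i`-th variable, so it gives the traces of `Ψ` on the hyperplanes
`zᵢ = a` and `zᵢ = zⱼ`. -/
noncomputable def lineValue {N : ℕ} (G : Fin N → (Fin N → ℝ) → ℂ) (i : Fin N)
    (z : Fin N → ℝ) (t : ℝ) : ℂ :=
  ∫ s in (0 : ℝ)..t, G i (Function.update z i s)

/-- `Ψ` is a normalized bosonic wave function in the form domain of the `N`-particle Hamiltonian, with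
weak partial derivatives `∂ᵢΨ = G i`: `Ψ` is permutation symmetric, belongs to `H₀¹([0,1]^N)`
(its derivatives are square integrable and it is, on almost every line parallel to a coordinate axis,
the primitive of its derivative that vanishes at both ends), and the potential energy is finite. -/
structure IsBosonicAdmissible {N : ℕ} (V : Potential) (Ψ : (Fin N → ℝ) → ℂ)
    (G : Fin N → (Fin N → ℝ) → ℂ) : Prop where
  memLp : MemLp Ψ 2 (cube N)
  symm : ∀ σ : Equiv.Perm (Fin N), ∀ᵐ z ∂cube N, Ψ (z ∘ σ) = Ψ z
  memLp_grad : ∀ i, MemLp (G i) 2 (cube N)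
  eq_lineValue : ∀ i, ∀ᵐ z ∂cube N, Ψ z = lineValue G i z (z i)
  lineValue_one : ∀ i, ∀ᵐ z ∂cube N, lineValue G i z 1 = 0
  integrable_potential : ∀ i, Integrable
    (fun p : (Fin N → ℝ) × ℝ => ‖lineValue G i p.1 p.2‖ ^ 2) ((cube N).prod V.measure)
  normalized : ∫ z, ‖Ψ z‖ ^ 2 ∂cube N = 1

/-- The expectation value of the Lieb-Liniger Hamiltonian
`H = ∑ᵢ (-∂ᵢ² + V(zᵢ)) + (γ/N) ∑_{i<j} δ(zᵢ - zⱼ)` in the state `Ψ` with gradient `G`.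
The integrands of the potential and of the interaction term do not depend on `zᵢ`
(the `i`-th variable has been replaced by `t` and by `zⱼ`, respectively), so that the integration over
`zᵢ ∈ [0,1]` only contributes a factor `1`. -/
noncomputable def manyBodyForm {N : ℕ} (V : Potential) (γ : ℝ)
    (G : Fin N → (Fin N → ℝ) → ℂ) : ℝ :=
  (∑ i, ((∫ z, ‖G i z‖ ^ 2 ∂cube N)
      + ∫ p : (Fin N → ℝ) × ℝ, ‖lineValue G i p.1 p.2‖ ^ 2 ∂((cube N).prod V.measure)))
    + γ / N * ∑ i, ∑ j ∈ Finset.Ioi i, ∫ z, ‖lineValue G i z (z j)‖ ^ 2 ∂cube N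

/-- The bosonic ground state energy of the `N`-particle Hamiltonian with Dirichlet boundary
conditions: the infimum of its expectation values over all normalized bosonic `Ψ` in the
form domain. -/
noncomputable def groundStateEnergy (N : ℕ) (V : Potential) (γ : ℝ) : ℝ :=
  sInf {E : ℝ | ∃ (Ψ : (Fin N → ℝ) → ℂ) (G : Fin N → (Fin N → ℝ) → ℂ),
    IsBosonicAdmissible V Ψ G ∧ E = manyBodyForm V γ G}

end LiebLiniger

/-!
Write `ρ = ψ₀²`, `D = ∫ ρ²`, and let `e` be the Gross-Pitaevskii energy.

*Minimizer.* A minimizing sequence is bounded in `H₀¹`, so along a subsequence its derivatives converge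
weakly in `L²` and its values converge pointwise and boundedly. The kinetic energy is weakly lower
semicontinuous, the potential energy is handled by Fatou's lemma, and the other integrals converge
(`exists_isAdmissible_minimizer`). Since `|‖f‖'| ≤ ‖f'‖` (`abs_deriv_norm_le`), the minimizer may be
replaced by its absolute value.

*Mean-field energy.* The functional is convex in the density: `√((1-t) ψ₀² + t |φ|²)` is an admissible
competitor whose kinetic energy is at most the convex combination
(`IsH01.exists_sqrt_combination`). Differentiating at `t = 0` gives `⟨φ, h φ⟩ ≥ e` for every normalized
`φ`, with equality for `φ = ψ₀` (`meanField_lower_bound_of_minimizer`).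

*Upper bound.* The product of `N` copies of `ψ₀` is a trial state (`groundStateEnergy_le`).

*Lower bound.* Let `w(x) = exp (-|x| / R) / (2 R)`. The fundamental theorem of calculus on both sides of
`y` shows that `|f(y)|²` differs from `∫ w(x - y) |f(x)|² dx` by at most
`∫ exp (-|x - y| / R) |f| |f'|` (`abs_normSq_sub_average_le`). This is used twice. First, at the price
of a fraction `ε` of the kinetic energy, the delta interaction can be replaced by `(1 - θ) w` with
`θ = γ R / (2 ε)` (`IsH01.regularized_delta_le`). As `w` is positive definite, the interaction energy
of the measure `∑ᵢ δ(zᵢ) - N ρ` is nonnegative, which bounds the pair interaction from below by the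
one-particle potential `w * ρ`, up to the self-energies `w(0) / 2` of the particles
(`sum_expKernel_lower_bound`). Secondly, `w * ρ` is compared with `ρ` in the sense of quadratic forms
(`IsH01.integral_mul_normSq_le`). What remains is a sum of mean-field Hamiltonians, each bounded below by
`e`. The errors, relative to `e`, are of order `ε`, `γ R`, the interaction energy times `θ`, and
`γ / (N R)`; the choice `R = N ^ (-2/3)`, `ε = N ^ (-1/3) min {√γ, γ}` makes all of them `O(ε)`, by
the a priori bounds `e ≥ 1/4`, `γ ≤ 2 e` and `ρ ≤ 2 √e`
(`IsBosonicAdmissible.energy_lower_bound`).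

The many-body wave function enters only through its restrictions to lines parallel to the axes; the
estimates are one-dimensional estimates on these slices, integrated over the remaining coordinates by
means of `measurePreserving_update`.
-/

namespace LiebLiniger

open Filter Topology

/-! ### Absolutely continuous functions and `H₀¹` -/

/-- Lebesgue measure on the unit interval. -/
noncomputable abbrev unitMeasure : Measure ℝ := volume.restrict (Icc (0 : ℝ) 1)

instance : IsProbabilityMeasure unitMeasure := ⟨by simp [unitMeasure]⟩

/-- A function whose increments are dominated by those of an absolutely continuous function is
absolutely continuous. -/
theorem absolutelyContinuousOnInterval_of_dist_le {X Y : Type*} [PseudoMetricSpace X]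
    [PseudoMetricSpace Y] {f : ℝ → X} {p : ℝ → Y} {a b : ℝ}
    (hp : AbsolutelyContinuousOnInterval p a b)
    (h : ∀ x ∈ uIcc a b, ∀ y ∈ uIcc a b, dist (f x) (f y) ≤ dist (p x) (p y)) :
    AbsolutelyContinuousOnInterval f a b := by
  rw [absolutelyContinuousOnInterval_iff] at *
  intro ε hε
  obtain ⟨δ, hδ, H⟩ := hp ε hε
  refine ⟨δ, hδ, fun E hE hs => lt_of_le_of_lt (Finset.sum_le_sum fun i hi => ?_) (H E hE hs)⟩
  exact h _ (hE.1 i hi).1 _ (hE.1 i hi).2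

theorem integral_unit_eq_intervalIntegral {E : Type*} [NormedAddCommGroup E] [NormedSpace ℝ E]
    (f : ℝ → E) : ∫ x, f x ∂unitMeasure = ∫ x in (0 : ℝ)..1, f x := by
  rw [intervalIntegral.integral_of_le zero_le_one, integral_Icc_eq_integral_Ioc]

theorem intervalIntegrable_of_unit {E : Type*} [NormedAddCommGroup E] {df : ℝ → E}
    (hdf : Integrable df unitMeasure) {a b : ℝ}
    (ha : a ∈ Icc (0 : ℝ) 1) (hb : b ∈ Icc (0 : ℝ) 1) : IntervalIntegrable df volume a b := by
  refine IntegrableOn.intervalIntegrable (hdf.mono_measure (Measure.restrict_mono ?_ le_rfl))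
  exact ordConnected_Icc.uIcc_subset ha hb

section Primitive

variable {E : Type*} [NormedAddCommGroup E] [NormedSpace ℝ E] {f df : ℝ → E}

theorem dist_primitive_le (hdf : Integrable df unitMeasure)
    (hf : ∀ x ∈ Icc (0 : ℝ) 1, f x = ∫ t in (0 : ℝ)..x, df t) {x y : ℝ}
    (hx : x ∈ Icc (0 : ℝ) 1) (hy : y ∈ Icc (0 : ℝ) 1) :
    dist (f x) (f y) ≤ dist (∫ t in (0 : ℝ)..x, ‖df t‖) (∫ t in (0 : ℝ)..y, ‖df t‖) := by
  have h0 : (0 : ℝ) ∈ Icc (0 : ℝ) 1 := by simp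
  rw [hf x hx, hf y hy, dist_eq_norm, dist_eq_norm,
    intervalIntegral.integral_interval_sub_left (intervalIntegrable_of_unit hdf h0 hx)
      (intervalIntegrable_of_unit hdf h0 hy),
    intervalIntegral.integral_interval_sub_left (intervalIntegrable_of_unit hdf.norm h0 hx)
      (intervalIntegrable_of_unit hdf.norm h0 hy)]
  exact intervalIntegral.norm_integral_le_abs_integral_norm

theorem continuousOn_primitive (hdf : Integrable df unitMeasure)
    (hf : ∀ x ∈ Icc (0 : ℝ) 1, f x = ∫ t in (0 : ℝ)..x, df t) : ContinuousOn f (Icc 0 1) := by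
  have h := intervalIntegral.continuousOn_primitive_interval (a := 0) (b := 1) (μ := volume)
    (f := df) (by rwa [uIcc_of_le zero_le_one])
  rw [uIcc_of_le zero_le_one] at h
  exact h.congr hf

theorem absolutelyContinuousOnInterval_norm_primitive (hdf : Integrable df unitMeasure)
    (hf : ∀ x ∈ Icc (0 : ℝ) 1, f x = ∫ t in (0 : ℝ)..x, df t) :
    AbsolutelyContinuousOnInterval (fun x => ‖f x‖) 0 1 := by
  have h0 : (0 : ℝ) ∈ Icc (0 : ℝ) 1 := by simp
  have h1 : (1 : ℝ) ∈ Icc (0 : ℝ) 1 := by simp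
  refine absolutelyContinuousOnInterval_of_dist_le
    (IntervalIntegrable.absolutelyContinuousOnInterval_intervalIntegral
      (intervalIntegrable_of_unit hdf.norm h0 h1) (c := 0) (by simp)) ?_
  intro x hx y hy
  rw [uIcc_of_le zero_le_one] at hx hy
  exact (dist_norm_norm_le _ _).trans (by simpa [dist_eq_norm] using dist_primitive_le hdf hf hx hy)

/-- The diamagnetic inequality in one dimension: `|‖f‖'| ≤ ‖f'‖` almost everywhere. -/
theorem abs_deriv_norm_le (hdf : Integrable df unitMeasure)
    (hf : ∀ x ∈ Icc (0 : ℝ) 1, f x = ∫ t in (0 : ℝ)..x, df t) :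
    ∀ᵐ x ∂unitMeasure, |deriv (fun x => ‖f x‖) x| ≤ ‖df x‖ := by
  have h0 : (0 : ℝ) ∈ Icc (0 : ℝ) 1 := by simp
  have h1 : (1 : ℝ) ∈ Icc (0 : ℝ) 1 := by simp
  have hne0 : ∀ᵐ x : ℝ, x ≠ 0 := by simp [ae_iff, measure_singleton]
  have hne1 : ∀ᵐ x : ℝ, x ≠ 1 := by simp [ae_iff, measure_singleton]
  refine (ae_restrict_iff' measurableSet_Icc).2 ?_
  filter_upwards [(absolutelyContinuousOnInterval_norm_primitive hdf hf).ae_differentiableAt,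
    (intervalIntegrable_of_unit hdf.norm h0 h1).ae_hasDerivAt_integral, hne0, hne1]
    with x hx1 hx2 hx0' hx1' hx
  have hx' : x ∈ uIcc (0 : ℝ) 1 := by rwa [uIcc_of_le zero_le_one]
  have d1 := (hx1 hx').hasDerivAt
  have d2 := hx2 hx' 0 (by simp)
  have t1 := (hasDerivAt_iff_tendsto_slope.1 d1).abs
  have t2 := (hasDerivAt_iff_tendsto_slope.1 d2).abs
  have : |‖df x‖| = ‖df x‖ := abs_norm _
  rw [← this]
  refine le_of_tendsto_of_tendsto t1 t2 ?_
  have hmem : Ioo (0 : ℝ) 1 ∈ nhds x :=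
    isOpen_Ioo.mem_nhds ⟨lt_of_le_of_ne hx.1 (Ne.symm hx0'), lt_of_le_of_ne hx.2 hx1'⟩
  filter_upwards [mem_nhdsWithin_of_mem_nhds hmem] with y hy
  have hd := (dist_norm_norm_le (f y) (f x)).trans (by
    simpa [dist_eq_norm] using dist_primitive_le hdf hf ⟨hy.1.le, hy.2.le⟩ hx)
  simp only [slope, vsub_eq_sub, smul_eq_mul, abs_mul]
  refine mul_le_mul_of_nonneg_left ?_ (abs_nonneg _)
  simpa [Real.dist_eq, Real.norm_eq_abs] using hd

theorem norm_primitive_zero (hf : ∀ x ∈ Icc (0 : ℝ) 1, f x = ∫ t in (0 : ℝ)..x, df t) :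
    f 0 = 0 := by
  simpa using hf 0 (by simp)

/-- The norm of a vector-valued `H₀¹` function is an `H₀¹` function. -/
theorem isH01_norm (hdf : MemLp df 2 unitMeasure)
    (hf : ∀ x ∈ Icc (0 : ℝ) 1, f x = ∫ t in (0 : ℝ)..x, df t) (hf1 : f 1 = 0) :
    IsH01 (fun x => ((‖f x‖ : ℝ) : ℂ)) (fun x => ((deriv (fun y => ‖f y‖) x : ℝ) : ℂ)) := by
  have hi := hdf.integrable (by norm_num)
  have hac := absolutelyContinuousOnInterval_norm_primitive hi hf
  refine ⟨?_, fun x hx => ?_, by simp [hf1]⟩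
  · refine hdf.norm.of_le (f := fun x => ((deriv (fun y => ‖f y‖) x : ℝ) : ℂ)) ?_ ?_
    · exact (Complex.measurable_ofReal.comp (measurable_deriv _)).aestronglyMeasurable
    · filter_upwards [abs_deriv_norm_le hi hf] with x hx
      simpa using hx
  · have h := (hac.mono (c := 0) (d := x) (by
      rw [uIcc_of_le zero_le_one, uIcc_of_le hx.1]
      exact Icc_subset_Icc_right hx.2)).integral_deriv_eq_sub
    rw [intervalIntegral.integral_ofReal, h, norm_primitive_zero hf]
    simp

theorem absolutelyContinuousOnInterval_normSq_primitive (hdf : Integrable df unitMeasure)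
    (hf : ∀ x ∈ Icc (0 : ℝ) 1, f x = ∫ t in (0 : ℝ)..x, df t) :
    AbsolutelyContinuousOnInterval (fun x => ‖f x‖ ^ 2) 0 1 := by
  have h := absolutelyContinuousOnInterval_norm_primitive hdf hf
  simpa [sq] using h.fun_mul h

theorem abs_deriv_normSq_le (hdf : Integrable df unitMeasure)
    (hf : ∀ x ∈ Icc (0 : ℝ) 1, f x = ∫ t in (0 : ℝ)..x, df t) :
    ∀ᵐ x ∂unitMeasure, |deriv (fun x => ‖f x‖ ^ 2) x| ≤ 2 * ‖f x‖ * ‖df x‖ := by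
  have hd := (absolutelyContinuousOnInterval_norm_primitive hdf hf).ae_differentiableAt
  filter_upwards [abs_deriv_norm_le hdf hf, ae_restrict_of_ae hd, ae_restrict_mem measurableSet_Icc]
    with x hx hx1 hx2
  have hD := (hx1 (by rwa [uIcc_of_le zero_le_one])).hasDerivAt.fun_pow 2
  have : deriv (fun x => ‖f x‖ ^ 2) x = 2 * ‖f x‖ * deriv (fun x => ‖f x‖) x := by
    simpa using hD.deriv
  rw [this, abs_mul, abs_of_nonneg (by positivity)]
  gcongr

end Primitive

/-- The exponential kernel `exp (-|x - y| / R)`. -/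
noncomputable def expKernel (R x y : ℝ) : ℝ := Real.exp (-(|x - y| / R))

theorem expKernel_nonneg (R x y : ℝ) : 0 ≤ expKernel R x y := (Real.exp_pos _).le

theorem expKernel_le_one {R : ℝ} (hR : 0 < R) (x y : ℝ) : expKernel R x y ≤ 1 :=
  Real.exp_le_one_iff.2 (by have := div_nonneg (abs_nonneg (x - y)) hR.le; linarith)

theorem expKernel_comm (R x y : ℝ) : expKernel R x y = expKernel R y x := by
  rw [expKernel, expKernel, abs_sub_comm]

theorem expKernel_self (R x : ℝ) : expKernel R x x = 1 := by simp [expKernel]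

theorem continuous_expKernel (R : ℝ) : Continuous fun p : ℝ × ℝ => expKernel R p.1 p.2 := by
  unfold expKernel; fun_prop

section Primitive

variable {E : Type*} [NormedAddCommGroup E] [NormedSpace ℝ E] {f df : ℝ → E}

theorem integrable_norm_mul_norm (hdf : MemLp df 2 unitMeasure)
    (hf : ∀ x ∈ Icc (0 : ℝ) 1, f x = ∫ t in (0 : ℝ)..x, df t) :
    Integrable (fun x => ‖f x‖ * ‖df x‖) unitMeasure := by
  have hi := hdf.integrable (by norm_num)
  have hc := continuousOn_primitive hi hf
  exact IntegrableOn.continuousOn_mul hc.norm hi.norm isCompact_Icc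

theorem integrable_normSq_primitive (hdf : Integrable df unitMeasure)
    (hf : ∀ x ∈ Icc (0 : ℝ) 1, f x = ∫ t in (0 : ℝ)..x, df t) :
    Integrable (fun x => ‖f x‖ ^ 2) unitMeasure :=
  ((continuousOn_primitive hdf hf).norm.pow 2).integrableOn_compact isCompact_Icc

/-- The one-dimensional Sobolev inequality `‖f‖_∞² ≤ 2 ‖f‖₂ ‖f'‖₂`, with the product on the right
bounded by a weighted sum. -/
theorem normSq_le_of_primitive (hdf : MemLp df 2 unitMeasure)
    (hf : ∀ x ∈ Icc (0 : ℝ) 1, f x = ∫ t in (0 : ℝ)..x, df t) {s : ℝ} (hs : 0 < s) {y : ℝ}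
    (hy : y ∈ Icc (0 : ℝ) 1) :
    ‖f y‖ ^ 2 ≤ s * (∫ x, ‖f x‖ ^ 2 ∂unitMeasure) + s⁻¹ * ∫ x, ‖df x‖ ^ 2 ∂unitMeasure := by
  have hi := hdf.integrable (by norm_num)
  have hac := absolutelyContinuousOnInterval_normSq_primitive hi hf
  have h := (hac.mono (c := 0) (d := y) (by
      rw [uIcc_of_le zero_le_one, uIcc_of_le hy.1]
      exact Icc_subset_Icc_right hy.2)).integral_deriv_eq_sub
  rw [norm_primitive_zero hf] at h
  have hint : IntegrableOn (deriv fun x => ‖f x‖ ^ 2) (Icc 0 1) := by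
    have := hac.intervalIntegrable_deriv
    rwa [intervalIntegrable_iff_integrableOn_Icc_of_le zero_le_one] at this
  calc ‖f y‖ ^ 2 = ∫ x in Ioc 0 y, deriv (fun x => ‖f x‖ ^ 2) x := by
        rw [← intervalIntegral.integral_of_le hy.1, h]; simp
    _ ≤ ∫ x in Ioc 0 y, |deriv (fun x => ‖f x‖ ^ 2) x| := (le_abs_self _).trans abs_integral_le_integral_abs
    _ ≤ ∫ x, |deriv (fun x => ‖f x‖ ^ 2) x| ∂unitMeasure := by
        refine setIntegral_mono_set hint.abs (Filter.Eventually.of_forall fun _ => abs_nonneg _) ?_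
        exact (Ioc_subset_Icc_self.trans (Icc_subset_Icc_right hy.2)).eventuallyLE
    _ ≤ ∫ x, (s * ‖f x‖ ^ 2 + s⁻¹ * ‖df x‖ ^ 2) ∂unitMeasure := by
        refine integral_mono_ae hint.abs
          (((integrable_normSq_primitive hi hf).const_mul _).add (hdf.norm.integrable_sq.const_mul _)) ?_
        filter_upwards [abs_deriv_normSq_le hi hf] with x hx
        refine hx.trans ?_
        have : 0 ≤ s⁻¹ * (s * ‖f x‖ - ‖df x‖) ^ 2 := by positivity
        have h2 : s⁻¹ * (s * ‖f x‖ - ‖df x‖) ^ 2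
            = s * ‖f x‖ ^ 2 + s⁻¹ * ‖df x‖ ^ 2 - 2 * ‖f x‖ * ‖df x‖ := by
          field_simp; ring
        linarith
    _ = _ := by
        rw [integral_add ((integrable_normSq_primitive hi hf).const_mul _)
          (hdf.norm.integrable_sq.const_mul _), integral_const_mul, integral_const_mul]

/-- The value of `‖f‖²` at a point differs from its average with the exponential kernel of range `R`
by at most `∫ exp (-|x - y| / R) ‖f‖ ‖f'‖`. -/
theorem abs_normSq_sub_average_le (hdf : MemLp df 2 unitMeasure)
    (hf : ∀ x ∈ Icc (0 : ℝ) 1, f x = ∫ t in (0 : ℝ)..x, df t) (hf1 : f 1 = 0) {R : ℝ}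
    (hR : 0 < R) {y : ℝ} (hy : y ∈ Icc (0 : ℝ) 1) :
    |‖f y‖ ^ 2 - (2 * R)⁻¹ * ∫ x, expKernel R x y * ‖f x‖ ^ 2 ∂unitMeasure|
      ≤ ∫ x, expKernel R x y * (‖f x‖ * ‖df x‖) ∂unitMeasure := by
  have hi := hdf.integrable (by norm_num)
  have hac := absolutelyContinuousOnInterval_normSq_primitive hi hf
  set v : ℝ → ℝ := fun x => ‖f x‖ ^ 2 with hv
  have hvint : IntegrableOn v (Icc 0 1) := integrable_normSq_primitive hi hf
  have hint : IntegrableOn (deriv v) (Icc 0 1) := by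
    have := hac.intervalIntegrable_deriv
    rwa [intervalIntegrable_iff_integrableOn_Icc_of_le zero_le_one] at this
  have hEc : Continuous fun x => expKernel R x y := by unfold expKernel; fun_prop
  have hqE : IntegrableOn (fun x => deriv v x * expKernel R x y) (Icc 0 1) :=
    hint.mul_continuousOn hEc.continuousOn isCompact_Icc
  have hvE : IntegrableOn (fun x => v x * expKernel R x y) (Icc 0 1) :=
    hvint.mul_continuousOn hEc.continuousOn isCompact_Icc
  have h0 : (0 : ℝ) ∈ Icc (0 : ℝ) 1 := by simp
  have h1 : (1 : ℝ) ∈ Icc (0 : ℝ) 1 := by simp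
  have ii {g : ℝ → ℝ} (hg : Integrable g unitMeasure) {a b : ℝ} (ha : a ∈ Icc (0 : ℝ) 1)
      (hb : b ∈ Icc (0 : ℝ) 1) : IntervalIntegrable g volume a b :=
    intervalIntegrable_of_unit hg ha hb
  have hL : (∫ x in (0 : ℝ)..y, deriv v x * expKernel R x y)
      + R⁻¹ * (∫ x in (0 : ℝ)..y, v x * expKernel R x y) = v y := by
    have hg : AbsolutelyContinuousOnInterval (fun x => Real.exp ((x - y) / R)) 0 y :=
      ContDiffOn.absolutelyContinuousOnInterval (by fun_prop)
    have hd : ∀ x, HasDerivAt (fun x => Real.exp ((x - y) / R)) (Real.exp ((x - y) / R) * (1 / R)) x :=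
      fun x => (((hasDerivAt_id x).sub_const y).div_const R).exp
    have h := (hac.mono (c := 0) (d := y) (by
      rw [uIcc_of_le zero_le_one, uIcc_of_le hy.1]
      exact Icc_subset_Icc_right hy.2)).integral_deriv_mul_eq_sub hg
    have h00 : v 0 = 0 := by simp [hv, norm_primitive_zero hf]
    rw [h00, sub_self, zero_div, Real.exp_zero, zero_mul, sub_zero, mul_one] at h
    rw [← h, ← intervalIntegral.integral_const_mul, ← intervalIntegral.integral_add (ii hqE h0 hy)
      ((ii hvE h0 hy).const_mul _)]
    refine intervalIntegral.integral_congr fun x hx => ?_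
    rw [uIcc_of_le hy.1] at hx
    have : expKernel R x y = Real.exp ((x - y) / R) := by
      rw [expKernel, abs_of_nonpos (by linarith [hx.2])]; congr 1; ring
    simp only [this, (hd x).deriv]
    ring
  have hU : -(∫ x in y..1, deriv v x * expKernel R x y)
      + R⁻¹ * (∫ x in y..1, v x * expKernel R x y) = v y := by
    have hg : AbsolutelyContinuousOnInterval (fun x => Real.exp (-((x - y) / R))) y 1 :=
      ContDiffOn.absolutelyContinuousOnInterval (by fun_prop)
    have hd : ∀ x, HasDerivAt (fun x => Real.exp (-((x - y) / R)))
        (Real.exp (-((x - y) / R)) * (-(1 / R))) x :=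
      fun x => (((hasDerivAt_id x).sub_const y).div_const R).neg.exp
    have h := (hac.mono (c := y) (d := 1) (by
      rw [uIcc_of_le zero_le_one, uIcc_of_le hy.2]
      exact Icc_subset_Icc_left hy.1)).integral_deriv_mul_eq_sub hg
    have h11 : v 1 = 0 := by simp [hv, hf1]
    rw [h11, sub_self, zero_div, neg_zero, Real.exp_zero, zero_mul, zero_sub, mul_one] at h
    rw [← neg_eq_iff_eq_neg.2 h, ← intervalIntegral.integral_const_mul, ← intervalIntegral.integral_neg,
      ← intervalIntegral.integral_neg, ← intervalIntegral.integral_add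
        (ii (g := fun x => -(deriv v x * expKernel R x y)) (Integrable.neg hqE) hy h1)
      ((ii hvE hy h1).const_mul _)]
    refine intervalIntegral.integral_congr fun x hx => ?_
    rw [uIcc_of_le hy.2] at hx
    have : expKernel R x y = Real.exp (-((x - y) / R)) := by
      rw [expKernel, abs_of_nonneg (by linarith [hx.1])]
    simp only [this, (hd x).deriv]
    ring
  have hsplit := intervalIntegral.integral_add_adjacent_intervals (ii hvE h0 hy) (ii hvE hy h1)
  have habs : |(∫ x in (0 : ℝ)..y, deriv v x * expKernel R x y)
      - ∫ x in y..1, deriv v x * expKernel R x y|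
      ≤ ∫ x, 2 * (expKernel R x y * (‖f x‖ * ‖df x‖)) ∂unitMeasure := by
    have e1 := intervalIntegral.abs_integral_le_integral_abs (μ := volume)
      (f := fun x => deriv v x * expKernel R x y) hy.1
    have e2 := intervalIntegral.abs_integral_le_integral_abs (μ := volume)
      (f := fun x => deriv v x * expKernel R x y) hy.2
    have e3 := intervalIntegral.integral_add_adjacent_intervals (ii hqE.abs h0 hy) (ii hqE.abs hy h1)
    have e4 : ∫ x in (0 : ℝ)..1, |deriv v x * expKernel R x y|
        ≤ ∫ x, 2 * (expKernel R x y * (‖f x‖ * ‖df x‖)) ∂unitMeasure := by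
      rw [← integral_unit_eq_intervalIntegral]
      refine integral_mono_ae hqE.abs (Integrable.const_mul ?_ 2) ?_
      · exact IntegrableOn.continuousOn_mul hEc.continuousOn (integrable_norm_mul_norm hdf hf)
          isCompact_Icc
      · filter_upwards [abs_deriv_normSq_le hi hf] with x hx
        rw [abs_mul, abs_of_nonneg (expKernel_nonneg R x y)]
        have := mul_le_mul_of_nonneg_right hx (expKernel_nonneg R x y)
        linarith
    have e5 := abs_sub (∫ x in (0 : ℝ)..y, deriv v x * expKernel R x y)
      (∫ x in y..1, deriv v x * expKernel R x y)
    linarith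
  rw [integral_const_mul] at habs
  have hcomm : ∫ x, expKernel R x y * v x ∂unitMeasure = ∫ x in (0 : ℝ)..1, v x * expKernel R x y := by
    rw [integral_unit_eq_intervalIntegral]
    exact intervalIntegral.integral_congr fun x _ => mul_comm _ _
  change |v y - (2 * R)⁻¹ * ∫ x, expKernel R x y * v x ∂unitMeasure| ≤ _
  rw [hcomm, ← hsplit]
  have key : 2 * (v y - (2 * R)⁻¹ * ((∫ x in (0 : ℝ)..y, v x * expKernel R x y)
      + ∫ x in y..1, v x * expKernel R x y))
      = (∫ x in (0 : ℝ)..y, deriv v x * expKernel R x y)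
      - ∫ x in y..1, deriv v x * expKernel R x y := by
    have : (2 * R)⁻¹ = R⁻¹ / 2 := by field_simp
    rw [this]
    linarith
  rw [← key, abs_mul, abs_of_pos (by norm_num : (0 : ℝ) < 2)] at habs
  linarith

end Primitive

/-! ### Admissible functions -/

theorem IsH01.integrable {ψ dψ : ℝ → ℂ} (h : IsH01 ψ dψ) : Integrable dψ unitMeasure :=
  h.memLp.integrable (by norm_num)

theorem IsH01.continuousOn {ψ dψ : ℝ → ℂ} (h : IsH01 ψ dψ) : ContinuousOn ψ (Icc 0 1) :=
  continuousOn_primitive h.integrable h.eq_integral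

theorem IsH01.integrable_normSq {ψ dψ : ℝ → ℂ} (h : IsH01 ψ dψ) :
    Integrable (fun x => ‖ψ x‖ ^ 2) unitMeasure :=
  integrable_normSq_primitive h.integrable h.eq_integral

theorem IsH01.integrable_normSq_deriv {ψ dψ : ℝ → ℂ} (h : IsH01 ψ dψ) :
    Integrable (fun x => ‖dψ x‖ ^ 2) unitMeasure :=
  h.memLp.norm.integrable_sq

theorem IsH01.const_mul {ψ dψ : ℝ → ℂ} (h : IsH01 ψ dψ) (c : ℂ) :
    IsH01 (fun x => c * ψ x) (fun x => c * dψ x) where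
  memLp := h.memLp.const_mul c
  eq_integral x hx := by rw [intervalIntegral.integral_const_mul, h.eq_integral x hx]
  right_eq_zero := by rw [h.right_eq_zero, mul_zero]

/-- The square root of a nonnegative combination of `|ψ|²` and `|φ|²` is in `H₀¹`, and its kinetic
energy density is at most the same combination of those of `ψ` and `φ`: it is the norm of the
vector-valued function `(√a ψ, √b φ)`. -/
theorem IsH01.exists_sqrt_combination {ψ dψ φ dφ : ℝ → ℂ} (hψ : IsH01 ψ dψ) (hφ : IsH01 φ dφ)
    {a b : ℝ} (ha : 0 ≤ a) (hb : 0 ≤ b) :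
    ∃ dg : ℝ → ℂ, IsH01 (fun x => ((Real.sqrt (a * ‖ψ x‖ ^ 2 + b * ‖φ x‖ ^ 2) : ℝ) : ℂ)) dg ∧
      ∀ᵐ x ∂unitMeasure, ‖dg x‖ ^ 2 ≤ a * ‖dψ x‖ ^ 2 + b * ‖dφ x‖ ^ 2 := by
  have hnorm (u v : ℂ) : ‖WithLp.toLp 2 (((Real.sqrt a : ℝ) : ℂ) * u, ((Real.sqrt b : ℝ) : ℂ) * v)‖
      = Real.sqrt (a * ‖u‖ ^ 2 + b * ‖v‖ ^ 2) := by
    rw [WithLp.prod_norm_eq_of_L2]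
    congr 1
    simp [mul_pow, Real.sq_sqrt, ha, hb]
  set F : ℝ → WithLp 2 (ℂ × ℂ) :=
    fun x => WithLp.toLp 2 (((Real.sqrt a : ℝ) : ℂ) * ψ x, ((Real.sqrt b : ℝ) : ℂ) * φ x) with hF
  set dF : ℝ → WithLp 2 (ℂ × ℂ) :=
    fun x => WithLp.toLp 2 (((Real.sqrt a : ℝ) : ℂ) * dψ x, ((Real.sqrt b : ℝ) : ℂ) * dφ x)
  have hpair : MemLp (fun x => (((Real.sqrt a : ℝ) : ℂ) * dψ x, ((Real.sqrt b : ℝ) : ℂ) * dφ x)) 2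
      unitMeasure := by
    have m1 := hψ.memLp.const_mul ((Real.sqrt a : ℝ) : ℂ)
    have m2 := hφ.memLp.const_mul ((Real.sqrt b : ℝ) : ℂ)
    refine (m1.norm.add m2.norm).of_le (m1.1.prodMk m2.1) (Eventually.of_forall fun x => ?_)
    refine le_trans ?_ (le_abs_self _)
    exact max_le (le_add_of_nonneg_right (norm_nonneg _)) (le_add_of_nonneg_left (norm_nonneg _))
  let L := (WithLp.prodContinuousLinearEquiv 2 ℝ ℂ ℂ).symm
  have hL : ∀ p : ℂ × ℂ, L p = WithLp.toLp 2 p := fun p => rfl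
  have hdFm : MemLp dF 2 unitMeasure := by
    have := L.toContinuousLinearMap.comp_memLp' hpair
    exact this
  have hFp : ∀ x ∈ Icc (0 : ℝ) 1, F x = ∫ t in (0 : ℝ)..x, dF t := by
    intro x hx
    have h0 : (0 : ℝ) ∈ Icc (0 : ℝ) 1 := by simp
    have i1 := intervalIntegrable_of_unit ((hψ.memLp.const_mul ((Real.sqrt a : ℝ) : ℂ)).integrable
      (by norm_num)) h0 hx
    have i2 := intervalIntegrable_of_unit ((hφ.memLp.const_mul ((Real.sqrt b : ℝ) : ℂ)).integrable
      (by norm_num)) h0 hx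
    have i3 := intervalIntegrable_of_unit (hpair.integrable (by norm_num)) h0 hx
    have e1 : ∫ t in (0 : ℝ)..x, dF t = L (∫ t in (0 : ℝ)..x,
        (((Real.sqrt a : ℝ) : ℂ) * dψ t, ((Real.sqrt b : ℝ) : ℂ) * dφ t)) :=
      L.toContinuousLinearMap.intervalIntegral_comp_comm i3
    rw [e1, hL, intervalIntegral.integral_of_le hx.1,
      integral_pair ((intervalIntegrable_iff_integrableOn_Ioc_of_le hx.1).1 i1)
      ((intervalIntegrable_iff_integrableOn_Ioc_of_le hx.1).1 i2),
      ← intervalIntegral.integral_of_le hx.1, ← intervalIntegral.integral_of_le hx.1,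
      intervalIntegral.integral_const_mul, intervalIntegral.integral_const_mul,
      ← hψ.eq_integral x hx, ← hφ.eq_integral x hx]
  have hF1 : F 1 = 0 := by
    simp only [hF, hψ.right_eq_zero, hφ.right_eq_zero, mul_zero]
    rfl
  have h := isH01_norm hdFm hFp hF1
  have h2 := abs_deriv_norm_le (hdFm.integrable (by norm_num)) hFp
  refine ⟨fun x => ((deriv (fun y => ‖F y‖) x : ℝ) : ℂ), ?_, ?_⟩
  · have e : (fun x => ((Real.sqrt (a * ‖ψ x‖ ^ 2 + b * ‖φ x‖ ^ 2) : ℝ) : ℂ))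
        = fun x => ((‖F x‖ : ℝ) : ℂ) := by
      funext x; rw [hF]; simp only [hnorm]
    rw [e]; exact h
  · filter_upwards [h2] with x hx
    have e : ‖dF x‖ = Real.sqrt (a * ‖dψ x‖ ^ 2 + b * ‖dφ x‖ ^ 2) := hnorm _ _
    rw [Complex.norm_real, Real.norm_eq_abs]
    rw [e] at hx
    have := pow_le_pow_left₀ (abs_nonneg _) hx 2
    rwa [Real.sq_sqrt (by positivity)] at this

theorem isH01_of_lipschitz {u : ℝ → ℝ} {K : NNReal} (hu : LipschitzWith K u) (h0 : u 0 = 0)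
    (h1 : u 1 = 0) : IsH01 (fun x => (u x : ℂ)) (fun x => ((deriv u x : ℝ) : ℂ)) where
  memLp := by
    refine MemLp.of_bound (Complex.measurable_ofReal.comp (measurable_deriv u)).aestronglyMeasurable
      K (Eventually.of_forall fun x => ?_)
    simpa using norm_deriv_le_of_lipschitz (x₀ := x) hu
  eq_integral x hx := by
    rw [intervalIntegral.integral_ofReal,
      (hu.lipschitzOnWith (s := uIcc 0 x)).absolutelyContinuousOnInterval.integral_deriv_eq_sub, h0,
      sub_zero]
  right_eq_zero := by simp [h1]

theorem Potential.ae_mem_Ioo (V : Potential) : ∀ᵐ x ∂V.measure, x ∈ Ioo (0 : ℝ) 1 := by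
  rw [Potential.measure, ae_add_measure_iff]
  constructor
  · exact (withDensity_absolutelyContinuous _ _).ae_le (ae_restrict_mem measurableSet_Ioo)
  · refine Measure.ae_sum_iff.2 fun k => ?_
    refine Measure.ae_smul_measure ?_ _
    exact (ae_dirac_iff measurableSet_Ioo).2 (V.site_mem k)

instance (V : Potential) : SFinite V.measure := by
  unfold Potential.measure; infer_instance

theorem Potential.measure_lt_top (V : Potential) {K : Set ℝ} (hK : IsCompact K)
    (hK' : K ⊆ Ioo (0 : ℝ) 1) : V.measure K < ⊤ := by
  rw [Potential.measure, Measure.add_apply]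
  refine ENNReal.add_lt_top.2 ⟨?_, V.strength_locallyFinite K hK hK'⟩
  rw [withDensity_apply _ hK.measurableSet, Measure.restrict_restrict hK.measurableSet,
    inter_eq_left.2 hK']
  have := (V.density_locallyIntegrable.integrableOn_compact_subset hK' hK).lintegral_lt_top
  exact this

theorem IsH01.aestronglyMeasurable_potential {ψ dψ : ℝ → ℂ} (h : IsH01 ψ dψ) (V : Potential) :
    AEStronglyMeasurable ψ V.measure := by
  rw [← Measure.restrict_eq_self_of_ae_mem V.ae_mem_Ioo]
  exact (h.continuousOn.mono Ioo_subset_Icc_self).aestronglyMeasurable measurableSet_Ioo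

/-- The form domain contains a normalized function: a tent supported away from the endpoints. -/
theorem exists_isAdmissible (V : Potential) : ∃ ψ dψ, IsAdmissible V ψ dψ := by
  set u : ℝ → ℝ := fun x => max (1 / 4 - |x - 1 / 2|) 0 with hu
  have hl : LipschitzWith 1 u := by
    refine LipschitzWith.of_dist_le_mul fun x y => ?_
    rw [Real.dist_eq, Real.dist_eq, NNReal.coe_one, one_mul]
    refine (abs_max_sub_max_le_abs _ _ _).trans ?_
    have := abs_abs_sub_abs_le_abs_sub (y - 1 / 2) (x - 1 / 2)
    rw [abs_sub_comm x y]
    rwa [sub_sub_sub_cancel_left, ← sub_sub_sub_cancel_right y x (1 / 2)]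
  have h0 : u 0 = 0 := by simp [hu]; norm_num [abs_of_pos]
  have h1 : u 1 = 0 := by simp [hu]; norm_num [abs_of_pos]
  have hH := isH01_of_lipschitz hl h0 h1
  have hpos : 0 < ∫ x, ‖(u x : ℂ)‖ ^ 2 ∂unitMeasure := by
    rw [integral_pos_iff_support_of_nonneg (fun x => by positivity) hH.integrable_normSq]
    refine lt_of_lt_of_le ?_ (measure_mono (s := Ioo (3 / 8 : ℝ) (5 / 8)) ?_)
    · rw [Measure.restrict_apply measurableSet_Ioo, inter_eq_left.2
        (Ioo_subset_Icc_self.trans (Icc_subset_Icc (by norm_num) (by norm_num)))]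
      simp; norm_num
    · intro x hx
      have : 0 < u x := by
        refine lt_max_of_lt_left ?_
        have : |x - 1 / 2| < 1 / 8 := abs_lt.2 ⟨by linarith [hx.1], by linarith [hx.2]⟩
        linarith
      simp [this.ne']
  have hV : Integrable (fun x => ‖(u x : ℂ)‖ ^ 2) V.measure := by
    have hK : Icc (1 / 4 : ℝ) (3 / 4) ⊆ Ioo (0 : ℝ) 1 := fun x hx =>
      ⟨by linarith [hx.1], by linarith [hx.2]⟩
    have hc : Continuous fun x => ‖(u x : ℂ)‖ ^ 2 := by
      have := hl.continuous
      fun_prop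
    refine IntegrableOn.integrable_of_forall_notMem_eq_zero (s := Icc (1 / 4 : ℝ) (3 / 4)) ?_ ?_
    · have : IsFiniteMeasure (V.measure.restrict (Icc (1 / 4 : ℝ) (3 / 4))) :=
        ⟨by simpa using V.measure_lt_top isCompact_Icc hK⟩
      refine MeasureTheory.Integrable.of_bound hc.aestronglyMeasurable 1
        (Eventually.of_forall fun x => ?_)
      have : |u x| ≤ 1 := by
        rw [abs_of_nonneg (le_max_right _ _)]
        exact max_le (by linarith [abs_nonneg (x - 1 / 2)]) zero_le_one
      simpa using this
    · intro x hx
      have : u x = 0 := by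
        refine max_eq_right ?_
        by_contra hlt
        push Not at hlt
        have := abs_lt.1 (by linarith : |x - 1 / 2| < 1 / 4)
        exact hx ⟨by linarith [this.1], by linarith [this.2]⟩
      simp [this]
  set m := ∫ x, ‖(u x : ℂ)‖ ^ 2 ∂unitMeasure with hm
  have hc2 : ‖(((Real.sqrt m)⁻¹ : ℝ) : ℂ)‖ ^ 2 = m⁻¹ := by
    rw [Complex.norm_real, Real.norm_eq_abs, sq_abs, inv_pow, Real.sq_sqrt hpos.le]
  refine ⟨_, _, hH.const_mul (((Real.sqrt m)⁻¹ : ℝ) : ℂ), ?_, ?_⟩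
  · simp only [norm_mul, mul_pow]
    exact hV.const_mul _
  · simp only [norm_mul, mul_pow]
    rw [integral_const_mul, hc2, ← hm, inv_mul_cancel₀ hpos.ne']

/-! ### The Gross-Pitaevskii functional -/

theorem IsH01.integrable_pow_four {ψ dψ : ℝ → ℂ} (h : IsH01 ψ dψ) :
    Integrable (fun x => ‖ψ x‖ ^ 4) unitMeasure :=
  (h.continuousOn.norm.pow 4).integrableOn_compact isCompact_Icc

theorem IsH01.integrable_mul_normSq {ψ dψ φ dφ : ℝ → ℂ} (hψ : IsH01 ψ dψ) (hφ : IsH01 φ dφ) :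
    Integrable (fun x => ‖ψ x‖ ^ 2 * ‖φ x‖ ^ 2) unitMeasure :=
  ((hψ.continuousOn.norm.pow 2).mul (hφ.continuousOn.norm.pow 2)).integrableOn_compact isCompact_Icc

theorem gpFunctional_nonneg (V : Potential) {γ : ℝ} (hγ : 0 ≤ γ) (ψ dψ : ℝ → ℂ) :
    0 ≤ gpFunctional V γ ψ dψ := by
  unfold gpFunctional
  have h1 : 0 ≤ ∫ x in Icc (0 : ℝ) 1, ‖dψ x‖ ^ 2 := integral_nonneg fun _ => by positivity
  have h2 : 0 ≤ ∫ x, ‖ψ x‖ ^ 2 ∂V.measure := integral_nonneg fun _ => by positivity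
  have h3 : 0 ≤ ∫ x in Icc (0 : ℝ) 1, ‖ψ x‖ ^ 4 := integral_nonneg fun _ => by positivity
  positivity

theorem gpEnergy_le (V : Potential) {γ : ℝ} (hγ : 0 ≤ γ) {ψ dψ : ℝ → ℂ}
    (h : IsAdmissible V ψ dψ) : gpEnergy V γ ≤ gpFunctional V γ ψ dψ :=
  csInf_le ⟨0, by rintro _ ⟨φ, dφ, -, rfl⟩; exact gpFunctional_nonneg V hγ φ dφ⟩ ⟨ψ, dψ, h, rfl⟩

/-- A minimizer minimizes also the quadratic form of its own mean-field Hamiltonian: the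
Gross-Pitaevskii functional is convex as a function of the density `|ψ|²`, and the linearization at
`ψ₀` is the mean-field form. -/
theorem meanField_lower_bound_of_minimizer (V : Potential) {γ : ℝ}
    {ψ dψ φ dφ : ℝ → ℂ}
    (hψ : IsAdmissible V ψ dψ) (hφ : IsAdmissible V φ dφ)
    (hmin : ∀ φ dφ : ℝ → ℂ, IsAdmissible V φ dφ →
      gpFunctional V γ ψ dψ ≤ gpFunctional V γ φ dφ) :
    gpFunctional V γ ψ dψ + γ / 2 * ∫ x, ‖ψ x‖ ^ 4 ∂unitMeasure
      ≤ (∫ x, ‖dφ x‖ ^ 2 ∂unitMeasure) + (∫ x, ‖φ x‖ ^ 2 ∂V.measure)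
        + γ * ∫ x, ‖ψ x‖ ^ 2 * ‖φ x‖ ^ 2 ∂unitMeasure := by
  set T₀ := ∫ x, ‖dψ x‖ ^ 2 ∂unitMeasure with hT₀
  set V₀ := ∫ x, ‖ψ x‖ ^ 2 ∂V.measure
  set D := ∫ x, ‖ψ x‖ ^ 4 ∂unitMeasure
  set T := ∫ x, ‖dφ x‖ ^ 2 ∂unitMeasure with hT
  set W := ∫ x, ‖φ x‖ ^ 2 ∂V.measure
  set Q := ∫ x, ‖ψ x‖ ^ 2 * ‖φ x‖ ^ 2 ∂unitMeasure
  set F := ∫ x, ‖φ x‖ ^ 4 ∂unitMeasure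
  have he : gpFunctional V γ ψ dψ = T₀ + V₀ + γ / 2 * D := rfl
  have step : ∀ t ∈ Ioo (0 : ℝ) 1, T₀ + V₀ + γ * D - (T + W + γ * Q)
      ≤ t * (γ / 2 * (D - 2 * Q + F)) := by
    intro t ht
    have h1t : 0 ≤ 1 - t := by linarith [ht.2]
    obtain ⟨dg, hg, hdg⟩ := hψ.isH01.exists_sqrt_combination hφ.isH01 h1t ht.1.le
    have hsq : ∀ x, ‖((Real.sqrt ((1 - t) * ‖ψ x‖ ^ 2 + t * ‖φ x‖ ^ 2) : ℝ) : ℂ)‖ ^ 2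
        = (1 - t) * ‖ψ x‖ ^ 2 + t * ‖φ x‖ ^ 2 := by
      intro x
      rw [Complex.norm_real, Real.norm_eq_abs, sq_abs, Real.sq_sqrt]
      exact add_nonneg (mul_nonneg h1t (by positivity)) (mul_nonneg ht.1.le (by positivity))
    have hqu : ∀ x, ‖((Real.sqrt ((1 - t) * ‖ψ x‖ ^ 2 + t * ‖φ x‖ ^ 2) : ℝ) : ℂ)‖ ^ 4
        = (1 - t) ^ 2 * ‖ψ x‖ ^ 4 + 2 * t * (1 - t) * (‖ψ x‖ ^ 2 * ‖φ x‖ ^ 2)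
          + t ^ 2 * ‖φ x‖ ^ 4 := by
      intro x
      rw [show (4 : ℕ) = 2 * 2 from rfl, pow_mul, hsq, pow_mul, pow_mul]; ring
    have hadm : IsAdmissible V _ dg := ⟨hg, by
        simp only [hsq]
        exact (hψ.integrable_potential.const_mul _).add (hφ.integrable_potential.const_mul _), by
        simp only [hsq]
        rw [integral_add (hψ.isH01.integrable_normSq.const_mul _)
          (hφ.isH01.integrable_normSq.const_mul _), integral_const_mul, integral_const_mul,
          hψ.normalized, hφ.normalized]
        ring⟩
    have hi : Integrable (fun x => (1 - t) ^ 2 * ‖ψ x‖ ^ 4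
        + 2 * t * (1 - t) * (‖ψ x‖ ^ 2 * ‖φ x‖ ^ 2)) unitMeasure :=
      (hψ.isH01.integrable_pow_four.const_mul _).add
        ((hψ.isH01.integrable_mul_normSq hφ.isH01).const_mul _)
    have hle := hmin _ _ hadm
    rw [he] at hle
    unfold gpFunctional at hle
    simp only [hsq, hqu] at hle
    rw [integral_add (hψ.integrable_potential.const_mul _) (hφ.integrable_potential.const_mul _),
      integral_const_mul, integral_const_mul,
      integral_add hi (hφ.isH01.integrable_pow_four.const_mul _),
      integral_add (hψ.isH01.integrable_pow_four.const_mul _)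
        ((hψ.isH01.integrable_mul_normSq hφ.isH01).const_mul _),
      integral_const_mul, integral_const_mul, integral_const_mul] at hle
    have hk : ∫ x, ‖dg x‖ ^ 2 ∂unitMeasure ≤ (1 - t) * T₀ + t * T := by
      rw [hT₀, hT, ← integral_const_mul, ← integral_const_mul,
        ← integral_add (hψ.isH01.integrable_normSq_deriv.const_mul _)
          (hφ.isH01.integrable_normSq_deriv.const_mul _)]
      exact integral_mono_ae hg.integrable_normSq_deriv
        ((hψ.isH01.integrable_normSq_deriv.const_mul _).add
          (hφ.isH01.integrable_normSq_deriv.const_mul _)) hdg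
    have hle' : T₀ + V₀ + γ / 2 * D ≤ (1 - t) * T₀ + t * T + ((1 - t) * V₀ + t * W)
        + γ / 2 * ((1 - t) ^ 2 * D + 2 * t * (1 - t) * Q + t ^ 2 * F) := by
      refine hle.trans ?_
      gcongr
    -- this inequality, divided by `t`, is the claim up to an error that vanishes as `t → 0`
    have : 0 ≤ t * (t * (γ / 2 * (D - 2 * Q + F)) - (T₀ + V₀ + γ * D - (T + W + γ * Q))) := by
      nlinarith
    linarith [nonneg_of_mul_nonneg_right this ht.1]
  have hlim : Tendsto (fun t : ℝ => t * (γ / 2 * (D - 2 * Q + F))) (𝓝[>] 0) (𝓝 0) := by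
    have : Tendsto (fun t : ℝ => t * (γ / 2 * (D - 2 * Q + F))) (𝓝 0)
      (𝓝 (0 * (γ / 2 * (D - 2 * Q + F)))) := (continuous_id.mul continuous_const).tendsto 0
    rw [zero_mul] at this
    exact this.mono_left nhdsWithin_le_nhds
  have := ge_of_tendsto hlim (by
    filter_upwards [Ioo_mem_nhdsGT (zero_lt_one (α := ℝ))] with t ht using step t ht)
  rw [he]
  linarith

/-- Bounded sequences in a separable Hilbert space have weakly convergent subsequences. -/
theorem exists_weakly_convergent_subseq {H : Type*} [NormedAddCommGroup H] [InnerProductSpace ℂ H]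
    [CompleteSpace H] [TopologicalSpace.SeparableSpace H] (x : ℕ → H) (C : ℝ)
    (hC : ∀ n, ‖x n‖ ≤ C) :
    ∃ (d : H) (k : ℕ → ℕ), StrictMono k ∧
      ∀ y, Tendsto (fun n => inner ℂ y (x (k n))) atTop (𝓝 (inner ℂ y d)) := by
  have hmem : ∀ n, StrongDual.toWeakDual (InnerProductSpace.toDual ℂ H (x n))
      ∈ (WeakDual.toStrongDual ⁻¹' Metric.closedBall (0 : StrongDual ℂ H) C) := by
    intro n
    simpa using hC n
  obtain ⟨a, -, k, hk, ha⟩ := WeakDual.isSeqCompact_closedBall ℂ H 0 C hmem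
  refine ⟨(InnerProductSpace.toDual ℂ H).symm (WeakDual.toStrongDual a), k, hk, fun y => ?_⟩
  have h := ((WeakDual.eval_continuous y).tendsto a).comp ha
  have h2 := (Complex.continuous_conj.tendsto _).comp h
  have e1 : (starRingEnd ℂ) (a y)
      = inner ℂ y ((InnerProductSpace.toDual ℂ H).symm (WeakDual.toStrongDual a)) := by
    rw [← inner_conj_symm, InnerProductSpace.toDual_symm_apply]; rfl
  rw [← e1]
  refine h2.congr fun n => ?_
  change (starRingEnd ℂ) (inner ℂ (x (k n)) y) = _
  rw [inner_conj_symm]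

theorem norm_toLp_sq {f : ℝ → ℂ} (hf : MemLp f 2 unitMeasure) :
    ‖hf.toLp f‖ ^ 2 = ∫ x, ‖f x‖ ^ 2 ∂unitMeasure := by
  have h := inner_self_eq_norm_sq (𝕜 := ℂ) (hf.toLp f)
  rw [L2.inner_def] at h
  have h2 : ∫ x, inner ℂ (hf.toLp f x) (hf.toLp f x) ∂unitMeasure
      = ∫ x, ((‖f x‖ ^ 2 : ℝ) : ℂ) ∂unitMeasure := by
    refine integral_congr_ae ?_
    filter_upwards [hf.coeFn_toLp] with x hx
    rw [hx, inner_self_eq_norm_sq_to_K]; norm_cast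
  rw [h2, integral_complex_ofReal] at h
  exact h.symm

/-- The direct method: bounded sequences in `H₀¹` have subsequences whose derivatives converge weakly
in `L²`, hence whose values converge pointwise. -/
theorem exists_isAdmissible_minimizer (V : Potential) {γ : ℝ} (hγ : 0 ≤ γ) :
    ∃ ψ dψ, IsAdmissible V ψ dψ ∧ gpFunctional V γ ψ dψ = gpEnergy V γ := by
  obtain ⟨ψ', dψ', h'⟩ := exists_isAdmissible V
  obtain ⟨E, hanti, hE, hEmem⟩ := exists_seq_tendsto_sInf
    (S := {E : ℝ | ∃ ψ dψ : ℝ → ℂ, IsAdmissible V ψ dψ ∧ E = gpFunctional V γ ψ dψ})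
    ⟨_, ψ', dψ', h', rfl⟩
    ⟨0, by rintro _ ⟨φ, dφ, -, rfl⟩; exact gpFunctional_nonneg V hγ φ dφ⟩
  choose ψ dψ hadm hEeq using hEmem
  change Tendsto E atTop (𝓝 (gpEnergy V γ)) at hE
  have hTn : ∀ n, 0 ≤ ∫ x, ‖dψ n x‖ ^ 2 ∂unitMeasure := fun n => integral_nonneg fun _ => by positivity
  have hVn : ∀ n, 0 ≤ ∫ x, ‖ψ n x‖ ^ 2 ∂V.measure := fun n => integral_nonneg fun _ => by positivity
  have hQn : ∀ n, 0 ≤ ∫ x, ‖ψ n x‖ ^ 4 ∂unitMeasure := fun n => integral_nonneg fun _ => by positivity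
  have hsum : ∀ n, E n = (∫ x, ‖dψ n x‖ ^ 2 ∂unitMeasure) + (∫ x, ‖ψ n x‖ ^ 2 ∂V.measure)
      + γ / 2 * ∫ x, ‖ψ n x‖ ^ 4 ∂unitMeasure := hEeq
  have hTb : ∀ n, ∫ x, ‖dψ n x‖ ^ 2 ∂unitMeasure ≤ E 0 := by
    intro n
    have := hsum n
    have h1 := mul_nonneg (by positivity : 0 ≤ γ / 2) (hQn n)
    linarith [hVn n, hanti n.zero_le]
  -- pass to a subsequence along which the kinetic energy converges
  obtain ⟨τ, -, k₁, hk₁, hτ⟩ := tendsto_subseq_of_bounded (Metric.isBounded_Icc 0 (E 0))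
    (x := fun n => ∫ x, ‖dψ n x‖ ^ 2 ∂unitMeasure) fun n => ⟨hTn n, hTb n⟩
  set d : ℕ → Lp ℂ 2 unitMeasure := fun n => (hadm (k₁ n)).isH01.memLp.toLp (dψ (k₁ n))
  have hdsq : ∀ n, ‖d n‖ ^ 2 = ∫ x, ‖dψ (k₁ n) x‖ ^ 2 ∂unitMeasure := fun n => norm_toLp_sq _
  have : Fact ((2 : ENNReal) ≠ ⊤) := ⟨by norm_num⟩
  obtain ⟨d₀, k₂, hk₂, hweak⟩ := exists_weakly_convergent_subseq d (Real.sqrt (E 0)) fun n =>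
    Real.le_sqrt_of_sq_le (by rw [hdsq]; exact hTb _)
  set k : ℕ → ℕ := fun n => k₁ (k₂ n)
  have hkt : Tendsto k atTop atTop := hk₁.tendsto_atTop.comp hk₂.tendsto_atTop
  have hτ' : Tendsto (fun n => ∫ x, ‖dψ (k n) x‖ ^ 2 ∂unitMeasure) atTop (𝓝 τ) :=
    hτ.comp hk₂.tendsto_atTop
  have hT : ‖d₀‖ ^ 2 ≤ τ := by
    have h1 : Tendsto (fun n => (inner ℂ d₀ (d (k₂ n))).re) atTop (𝓝 (‖d₀‖ ^ 2)) := by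
      have := (Complex.continuous_re.tendsto _).comp (hweak d₀)
      rw [← inner_self_eq_norm_sq (𝕜 := ℂ) d₀]
      exact this
    have h2 : Tendsto (fun n => (‖d₀‖ ^ 2 + ‖d (k₂ n)‖ ^ 2) / 2) atTop (𝓝 ((‖d₀‖ ^ 2 + τ) / 2)) := by
      refine (tendsto_const_nhds.add ?_).div_const 2
      refine hτ'.congr fun n => ?_
      rw [hdsq]
    have h3 := le_of_tendsto_of_tendsto' h1 h2 fun n => by
      have := (Complex.re_le_norm _).trans (norm_inner_le_norm (𝕜 := ℂ) d₀ (d (k₂ n)))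
      nlinarith [sq_nonneg (‖d₀‖ - ‖d (k₂ n)‖)]
    linarith
  set ψ₀ : ℝ → ℂ := fun x => ∫ t in (0 : ℝ)..x, d₀ t with hψ₀
  have hconv : ∀ x ∈ Icc (0 : ℝ) 1, Tendsto (fun n => ψ (k n) x) atTop (𝓝 (ψ₀ x)) := by
    intro x hx
    have hm : unitMeasure (Icc 0 x) ≠ ⊤ := measure_ne_top _ _
    have hres : ∀ f : ℝ → ℂ, ∫ t in Icc 0 x, f t ∂unitMeasure = ∫ t in (0 : ℝ)..x, f t := by
      intro f
      rw [unitMeasure, Measure.restrict_restrict measurableSet_Icc, inter_eq_left.2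
        (Icc_subset_Icc_right hx.2), integral_Icc_eq_integral_Ioc, intervalIntegral.integral_of_le hx.1]
    -- `ψ x` is the inner product of `ψ'` with the indicator function of `[0, x]`
    have h := hweak (indicatorConstLp 2 measurableSet_Icc hm (1 : ℂ))
    rw [L2.inner_indicatorConstLp_one, hres] at h
    refine h.congr fun n => ?_
    rw [L2.inner_indicatorConstLp_one, (hadm (k n)).isH01.eq_integral x hx, ← hres]
    exact integral_congr_ae (ae_restrict_of_ae (MemLp.coeFn_toLp _))
  have hbound : ∀ n, ∀ x ∈ Icc (0 : ℝ) 1, ‖ψ n x‖ ^ 2 ≤ 1 + E 0 := by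
    intro n x hx
    have := normSq_le_of_primitive (hadm n).isH01.memLp (hadm n).isH01.eq_integral zero_lt_one hx
    rw [(hadm n).normalized] at this
    linarith [hTb n]
  have hH : IsH01 ψ₀ d₀ := by
    refine ⟨Lp.memLp d₀, fun x _ => rfl, ?_⟩
    refine tendsto_nhds_unique (hconv 1 (by simp)) ?_
    simp [(hadm _).isH01.right_eq_zero]
  have hdct : ∀ m : ℕ, m ≠ 0 → Tendsto (fun n => ∫ x, ‖ψ (k n) x‖ ^ (2 * m) ∂unitMeasure) atTop
      (𝓝 (∫ x, ‖ψ₀ x‖ ^ (2 * m) ∂unitMeasure)) := by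
    intro m hm
    refine tendsto_integral_of_dominated_convergence (fun _ => (1 + E 0) ^ m) (fun n => ?_)
      (integrable_const _) (fun n => ?_) ?_
    · exact ((hadm (k n)).isH01.continuousOn.norm.pow _).aestronglyMeasurable measurableSet_Icc
    · filter_upwards [ae_restrict_mem measurableSet_Icc] with x hx
      rw [Real.norm_eq_abs, abs_of_nonneg (by positivity), pow_mul]
      exact pow_le_pow_left₀ (by positivity) (hbound _ x hx) m
    · filter_upwards [ae_restrict_mem measurableSet_Icc] with x hx
      exact (hconv x hx).norm.pow _
  have hnorm : ∫ x, ‖ψ₀ x‖ ^ 2 ∂unitMeasure = 1 := by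
    refine tendsto_nhds_unique (hdct 1 one_ne_zero) ?_
    refine tendsto_const_nhds.congr fun n => ?_
    exact (hadm (k n)).normalized.symm
  have hquart := hdct 2 two_ne_zero
  have hVlim : Tendsto (fun n => ∫ x, ‖ψ (k n) x‖ ^ 2 ∂V.measure) atTop
      (𝓝 (gpEnergy V γ - τ - γ / 2 * ∫ x, ‖ψ₀ x‖ ^ 4 ∂unitMeasure)) := by
    refine (((hE.comp hkt).sub hτ').sub (hquart.const_mul (γ / 2))).congr fun n => ?_
    simp only [Function.comp, hsum]
    ring
  set v := gpEnergy V γ - τ - γ / 2 * ∫ x, ‖ψ₀ x‖ ^ 4 ∂unitMeasure with hv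
  have hv0 : 0 ≤ v := ge_of_tendsto' hVlim fun n => hVn _
  have hmeas : AEStronglyMeasurable (fun x => ‖ψ₀ x‖ ^ 2) V.measure :=
    (hH.aestronglyMeasurable_potential V).norm.pow 2
  -- Fatou's lemma for the potential energy
  have hfatou : ∫⁻ x, ENNReal.ofReal (‖ψ₀ x‖ ^ 2) ∂V.measure ≤ ENNReal.ofReal v := by
    have h1 : ∫⁻ x, ENNReal.ofReal (‖ψ₀ x‖ ^ 2) ∂V.measure
        = ∫⁻ x, liminf (fun n => ENNReal.ofReal (‖ψ (k n) x‖ ^ 2)) atTop ∂V.measure := by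
      refine lintegral_congr_ae ?_
      filter_upwards [V.ae_mem_Ioo] with x hx
      refine (Tendsto.liminf_eq ?_).symm
      exact ENNReal.tendsto_ofReal ((hconv x (Ioo_subset_Icc_self hx)).norm.pow 2)
    rw [h1]
    refine (lintegral_liminf_le' fun n => ?_).trans ?_
    · exact (((hadm (k n)).isH01.aestronglyMeasurable_potential V).norm.pow 2).aemeasurable.ennreal_ofReal
    · refine le_of_eq (Tendsto.liminf_eq ?_)
      refine (ENNReal.tendsto_ofReal hVlim).congr fun n => ?_
      rw [ofReal_integral_eq_lintegral_ofReal (hadm (k n)).integrable_potential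
        (Eventually.of_forall fun x => by positivity)]
  have hintV : Integrable (fun x => ‖ψ₀ x‖ ^ 2) V.measure :=
    ⟨hmeas, (hasFiniteIntegral_iff_ofReal (Eventually.of_forall fun x => by positivity)).2
      (hfatou.trans_lt ENNReal.ofReal_lt_top)⟩
  have hVle : ∫ x, ‖ψ₀ x‖ ^ 2 ∂V.measure ≤ v := by
    rw [← ofReal_integral_eq_lintegral_ofReal hintV
      (Eventually.of_forall fun x => by positivity)] at hfatou
    exact (ENNReal.ofReal_le_ofReal_iff hv0).1 hfatou
  have hadm₀ : IsAdmissible V ψ₀ d₀ := ⟨hH, hintV, hnorm⟩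
  refine ⟨ψ₀, d₀, hadm₀, le_antisymm ?_ (gpEnergy_le V hγ hadm₀)⟩
  have hd₀ : ∫ x, ‖d₀ x‖ ^ 2 ∂unitMeasure = ‖d₀‖ ^ 2 := by
    rw [← norm_toLp_sq (Lp.memLp d₀), Lp.toLp_coeFn]
  have : gpFunctional V γ ψ₀ d₀ = ‖d₀‖ ^ 2 + (∫ x, ‖ψ₀ x‖ ^ 2 ∂V.measure)
      + γ / 2 * ∫ x, ‖ψ₀ x‖ ^ 4 ∂unitMeasure := by
    rw [← hd₀]; rfl
  rw [this]
  linarith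

/-- The absolute value of a minimizer is a nonnegative minimizer. -/
theorem exists_isGPMinimizer (V : Potential) {γ : ℝ} (hγ : 0 ≤ γ) :
    ∃ ψ₀ : ℝ → ℝ, IsGPMinimizer V γ ψ₀ := by
  obtain ⟨ψ, dψ, h, he⟩ := exists_isAdmissible_minimizer V hγ
  have hn := isH01_norm h.isH01.memLp h.isH01.eq_integral h.isH01.right_eq_zero
  have hdn := abs_deriv_norm_le h.isH01.integrable h.isH01.eq_integral
  have e : ∀ x, ‖((‖ψ x‖ : ℝ) : ℂ)‖ = ‖ψ x‖ := fun x => by simp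
  have hadm : IsAdmissible V (fun x => ((‖ψ x‖ : ℝ) : ℂ)) _ :=
    ⟨hn, by simpa only [e] using h.integrable_potential, by simpa only [e] using h.normalized⟩
  refine ⟨fun x => ‖ψ x‖, fun x _ => norm_nonneg _, _, hadm, fun φ dφ hφ => ?_⟩
  refine le_trans ?_ (gpEnergy_le V hγ hφ)
  rw [← he]
  unfold gpFunctional
  simp only [e]
  have : ∫ x in Icc (0 : ℝ) 1, ‖((deriv (fun y => ‖ψ y‖) x : ℝ) : ℂ)‖ ^ 2
      ≤ ∫ x in Icc (0 : ℝ) 1, ‖dψ x‖ ^ 2 := by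
    refine integral_mono_ae hn.integrable_normSq_deriv h.isH01.integrable_normSq_deriv ?_
    filter_upwards [hdn] with x hx
    rw [Complex.norm_real, Real.norm_eq_abs]
    exact pow_le_pow_left₀ (abs_nonneg _) hx 2
  gcongr

/-! ### Integration over the cube -/

theorem cube_eq_pi (N : ℕ) : cube N = Measure.pi fun _ : Fin N => unitMeasure := by
  rw [cube, volume_pi, ← pi_univ_Icc, ← Measure.restrict_pi_pi]
  rfl

instance (N : ℕ) : IsProbabilityMeasure (cube N) := by
  rw [cube_eq_pi]; infer_instance

theorem ae_cube_mem_Icc (N : ℕ) : ∀ᵐ z ∂cube N, ∀ i, z i ∈ Icc (0 : ℝ) 1 := by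
  filter_upwards [ae_restrict_mem (μ := volume) (measurableSet_Icc (a := (0 : Fin N → ℝ)) (b := 1))]
    with z hz i
  exact ⟨hz.1 i, hz.2 i⟩

/-- Resampling one coordinate uniformly preserves the measure of the cube. This is the form in which
Fubini's theorem is used to slice the cube into lines parallel to the `i`-th axis. -/
theorem measurePreserving_update {N : ℕ} (i : Fin N) :
    MeasurePreserving (fun p : (Fin N → ℝ) × ℝ => Function.update p.1 i p.2)
      ((cube N).prod unitMeasure) (cube N) := by
  have hm : Measurable fun p : (Fin N → ℝ) × ℝ => Function.update p.1 i p.2 := by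
    refine measurable_pi_lambda _ fun j => ?_
    by_cases h : j = i
    · subst h; simpa using measurable_snd
    · simp only [Function.update_of_ne h]; fun_prop
  refine ⟨hm, ?_⟩
  rw [cube_eq_pi]
  refine (Measure.pi_eq fun s hs => ?_).symm
  rw [Measure.map_apply hm (MeasurableSet.univ_pi hs)]
  have : (fun p : (Fin N → ℝ) × ℝ => Function.update p.1 i p.2) ⁻¹' (univ.pi s)
      = (univ.pi (Function.update s i univ)) ×ˢ s i := by
    ext p
    simp only [mem_preimage, Set.mem_pi, mem_univ, true_imp_iff, mem_prod]
    constructor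
    · intro h
      refine ⟨fun j => ?_, by simpa using h i⟩
      by_cases hj : j = i
      · subst hj; simp
      · simpa [Function.update_of_ne hj] using h j
    · rintro ⟨h1, h2⟩ j
      by_cases hj : j = i
      · subst hj; simpa using h2
      · simpa [Function.update_of_ne hj] using h1 j
  rw [this, Measure.prod_prod, Measure.pi_pi, ← Finset.mul_prod_erase _ _ (Finset.mem_univ i),
    ← Finset.mul_prod_erase _ (fun j => unitMeasure (s j)) (Finset.mem_univ i)]
  simp only [Function.update_self, measure_univ, one_mul]
  rw [mul_comm]
  congr 1
  refine Finset.prod_congr rfl fun j hj => ?_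
  rw [Function.update_of_ne (Finset.ne_of_mem_erase hj)]

theorem ae_ae_update {N : ℕ} (i : Fin N) {p : (Fin N → ℝ) → Prop} (h : ∀ᵐ z ∂cube N, p z) :
    ∀ᵐ z ∂cube N, ∀ᵐ t ∂unitMeasure, p (Function.update z i t) :=
  Measure.ae_ae_of_ae_prod ((measurePreserving_update i).quasiMeasurePreserving.ae h)

theorem integrable_update {N : ℕ} (i : Fin N) {E : Type*} [NormedAddCommGroup E]
    {f : (Fin N → ℝ) → E} (h : Integrable f (cube N)) :
    Integrable (fun p : (Fin N → ℝ) × ℝ => f (Function.update p.1 i p.2))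
      ((cube N).prod unitMeasure) :=
  (measurePreserving_update i).integrable_comp_of_integrable h

theorem integral_cube_eq_integral_update {N : ℕ} (i : Fin N) {E : Type*} [NormedAddCommGroup E]
    [NormedSpace ℝ E] {f : (Fin N → ℝ) → E} (h : Integrable f (cube N)) :
    ∫ z, f z ∂cube N = ∫ z, ∫ t, f (Function.update z i t) ∂unitMeasure ∂cube N := by
  rw [← integral_prod _ (integrable_update i h)]
  have hf := (measurePreserving_update i).map_eq
  conv_lhs => rw [← hf]
  rw [integral_map (measurePreserving_update i).aemeasurable (by rw [hf]; exact h.1)]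

theorem integral_cube_prod {N : ℕ} {𝕜 : Type*} [RCLike 𝕜] (f : Fin N → ℝ → 𝕜) :
    ∫ z, ∏ j, f j (z j) ∂cube N = ∏ j, ∫ x, f j x ∂unitMeasure := by
  rw [cube_eq_pi, integral_fintype_prod_eq_prod]

theorem integrable_cube_prod {N : ℕ} {𝕜 : Type*} [RCLike 𝕜] {f : Fin N → ℝ → 𝕜}
    (h : ∀ j, Integrable (f j) unitMeasure) : Integrable (fun z => ∏ j, f j (z j)) (cube N) := by
  rw [cube_eq_pi]; exact Integrable.fintype_prod h

theorem prod_update_apply {N : ℕ} {M : Type*} [CommMonoid M] (f : Fin N → ℝ → M) (i : Fin N)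
    (g : ℝ → M) (z : Fin N → ℝ) :
    ∏ j, (Function.update f i g) j (z j) = g (z i) * ∏ j ∈ Finset.univ.erase i, f j (z j) := by
  rw [← Finset.mul_prod_erase _ _ (Finset.mem_univ i), Function.update_self]
  congr 1
  refine Finset.prod_congr rfl fun j hj => ?_
  rw [Function.update_of_ne (Finset.ne_of_mem_erase hj)]

/-! ### The product trial state -/

section Trial

variable {N : ℕ} (ψ dψ : ℝ → ℂ)

/-- The product wave function `∏ⱼ ψ(zⱼ)`. -/
noncomputable def productState (N : ℕ) (z : Fin N → ℝ) : ℂ := ∏ j, ψ (z j)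

/-- The gradient of the product wave function. -/
noncomputable def productGrad (N : ℕ) (i : Fin N) (z : Fin N → ℝ) : ℂ :=
  ∏ j, (Function.update (fun _ => ψ) i dψ) j (z j)

variable {ψ dψ}

theorem lineValue_productGrad (h : IsH01 ψ dψ) (i : Fin N) (z : Fin N → ℝ) {t : ℝ}
    (ht : t ∈ Icc (0 : ℝ) 1) :
    lineValue (productGrad ψ dψ N) i z t = ψ t * ∏ j ∈ Finset.univ.erase i, ψ (z j) := by
  rw [lineValue, h.eq_integral t ht, ← intervalIntegral.integral_mul_const]
  refine intervalIntegral.integral_congr fun s _ => ?_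
  simp only [productGrad]
  rw [prod_update_apply, Function.update_self]
  congr 1
  refine Finset.prod_congr rfl fun j hj => ?_
  rw [Function.update_of_ne (Finset.ne_of_mem_erase hj)]

theorem memLp_two_cube_prod {f : Fin N → ℝ → ℂ} (h : ∀ j, MemLp (f j) 2 unitMeasure) :
    MemLp (fun z => ∏ j, f j (z j)) 2 (cube N) := by
  refine (memLp_two_iff_integrable_sq_norm
    (integrable_cube_prod fun j => (h j).integrable (by norm_num)).1).2 ?_
  simp only [norm_prod, ← Finset.prod_pow]
  exact integrable_cube_prod (f := fun j x => ‖f j x‖ ^ 2) fun j => (h j).norm.integrable_sq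

theorem integral_normSq_cube_prod (f : Fin N → ℝ → ℂ) :
    ∫ z, ‖∏ j, f j (z j)‖ ^ 2 ∂cube N = ∏ j, ∫ x, ‖f j x‖ ^ 2 ∂unitMeasure := by
  simp only [norm_prod, ← Finset.prod_pow]
  exact integral_cube_prod fun j x => ‖f j x‖ ^ 2

theorem IsH01.memLp_self (h : IsH01 ψ dψ) : MemLp ψ 2 unitMeasure :=
  (memLp_two_iff_integrable_sq_norm (h.continuousOn.aestronglyMeasurable measurableSet_Icc)).2
    h.integrable_normSq

theorem memLp_update_productGrad (h : IsH01 ψ dψ) (i j : Fin N) :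
    MemLp ((Function.update (fun _ => ψ) i dψ : Fin N → ℝ → ℂ) j) 2 unitMeasure := by
  by_cases hj : j = i
  · subst hj; simpa using h.memLp
  · simpa [Function.update_of_ne hj] using h.memLp_self

variable {V : Potential}

theorem normSq_productState_erase (i : Fin N) (z : Fin N → ℝ) :
    ‖∏ j ∈ Finset.univ.erase i, ψ (z j)‖ ^ 2
      = ∏ j, (Function.update (fun _ x => ‖ψ x‖ ^ 2) i 1 : Fin N → ℝ → ℝ) j (z j) := by
  rw [prod_update_apply]
  simp [norm_prod, Finset.prod_pow]

theorem integrable_normSq_productState_erase (h : IsH01 ψ dψ) (i : Fin N) :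
    Integrable (fun z : Fin N → ℝ => ‖∏ j ∈ Finset.univ.erase i, ψ (z j)‖ ^ 2) (cube N) := by
  simp only [normSq_productState_erase]
  refine integrable_cube_prod fun j => ?_
  by_cases hj : j = i
  · subst hj; rw [Function.update_self]; exact integrable_const (1 : ℝ)
  · simpa [Function.update_of_ne hj] using h.integrable_normSq

theorem integral_normSq_productState_erase (h : IsAdmissible V ψ dψ) (i : Fin N) :
    ∫ z : Fin N → ℝ, ‖∏ j ∈ Finset.univ.erase i, ψ (z j)‖ ^ 2 ∂cube N = 1 := by
  simp only [normSq_productState_erase]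
  rw [integral_cube_prod]
  refine Finset.prod_eq_one fun j _ => ?_
  by_cases hj : j = i
  · subst hj; simp
  · simpa [Function.update_of_ne hj] using h.normalized

theorem ae_prod_snd_mem_Ioo (V : Potential) (N : ℕ) :
    ∀ᵐ p ∂(cube N).prod V.measure, p.2 ∈ Ioo (0 : ℝ) 1 :=
  Measure.quasiMeasurePreserving_snd.ae V.ae_mem_Ioo

theorem ae_normSq_lineValue_productGrad (h : IsH01 ψ dψ) (V : Potential) (i : Fin N) :
    (fun p : (Fin N → ℝ) × ℝ => ‖lineValue (productGrad ψ dψ N) i p.1 p.2‖ ^ 2)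
      =ᵐ[(cube N).prod V.measure]
      fun p => ‖∏ j ∈ Finset.univ.erase i, ψ (p.1 j)‖ ^ 2 * ‖ψ p.2‖ ^ 2 := by
  filter_upwards [ae_prod_snd_mem_Ioo V N] with p hp
  rw [lineValue_productGrad h i p.1 (Ioo_subset_Icc_self hp), norm_mul, mul_pow, mul_comm]

theorem isBosonicAdmissible_productState (h : IsAdmissible V ψ dψ) :
    IsBosonicAdmissible V (productState ψ N) (productGrad ψ dψ N) where
  memLp := memLp_two_cube_prod fun _ => h.isH01.memLp_self
  symm σ := Eventually.of_forall fun z => Equiv.prod_comp σ fun j => ψ (z j)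
  memLp_grad i := memLp_two_cube_prod fun j => memLp_update_productGrad h.isH01 i j
  eq_lineValue i := by
    filter_upwards [ae_cube_mem_Icc N] with z hz
    rw [lineValue_productGrad h.isH01 i z (hz i), productState,
      Finset.mul_prod_erase _ (fun j => ψ (z j)) (Finset.mem_univ i)]
  lineValue_one i := Eventually.of_forall fun z => by
    rw [lineValue_productGrad h.isH01 i z (by simp), h.isH01.right_eq_zero, zero_mul]
  integrable_potential i := by
    rw [integrable_congr (ae_normSq_lineValue_productGrad h.isH01 V i)]
    exact (integrable_normSq_productState_erase h.isH01 i).mul_prod h.integrable_potential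
  normalized := by
    simp only [productState]
    rw [integral_normSq_cube_prod fun _ => ψ]
    exact Finset.prod_eq_one fun j _ => h.normalized

theorem integral_normSq_productGrad (h : IsAdmissible V ψ dψ) (i : Fin N) :
    ∫ z, ‖productGrad ψ dψ N i z‖ ^ 2 ∂cube N = ∫ x, ‖dψ x‖ ^ 2 ∂unitMeasure := by
  simp only [productGrad]
  rw [integral_normSq_cube_prod, ← Finset.mul_prod_erase _ _ (Finset.mem_univ i),
    Function.update_self, Finset.prod_eq_one, mul_one]
  intro j hj
  rw [Function.update_of_ne (Finset.ne_of_mem_erase hj)]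
  exact h.normalized

theorem integral_potential_productGrad (h : IsAdmissible V ψ dψ) (i : Fin N) :
    ∫ p : (Fin N → ℝ) × ℝ, ‖lineValue (productGrad ψ dψ N) i p.1 p.2‖ ^ 2 ∂((cube N).prod V.measure)
      = ∫ x, ‖ψ x‖ ^ 2 ∂V.measure := by
  rw [integral_congr_ae (ae_normSq_lineValue_productGrad h.isH01 V i),
    integral_prod_mul (fun z : Fin N → ℝ => ‖∏ j ∈ Finset.univ.erase i, ψ (z j)‖ ^ 2)
      fun x => ‖ψ x‖ ^ 2, integral_normSq_productState_erase h i, one_mul]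

theorem integral_interaction_productGrad (h : IsAdmissible V ψ dψ) {i j : Fin N} (hij : i ≠ j) :
    ∫ z, ‖lineValue (productGrad ψ dψ N) i z (z j)‖ ^ 2 ∂cube N
      = ∫ x, ‖ψ x‖ ^ 4 ∂unitMeasure := by
  set A : Fin N → ℝ → ℝ := Function.update (fun _ x => ‖ψ x‖ ^ 2) i 1 with hA
  have e : ∀ᵐ z ∂cube N, ‖lineValue (productGrad ψ dψ N) i z (z j)‖ ^ 2
      = ∏ k, (Function.update A j fun x => ‖ψ x‖ ^ 4) k (z k) := by
    filter_upwards [ae_cube_mem_Icc N] with z hz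
    have hAj : A j (z j) = ‖ψ (z j)‖ ^ 2 := by rw [hA, Function.update_of_ne hij.symm]
    rw [lineValue_productGrad h.isH01 i z (hz j), norm_mul, mul_pow, normSq_productState_erase,
      ← hA, prod_update_apply A j,
      ← Finset.mul_prod_erase _ (fun k => A k (z k)) (Finset.mem_univ j), hAj]
    ring
  rw [integral_congr_ae e, integral_cube_prod, ← Finset.mul_prod_erase _ _ (Finset.mem_univ j),
    Function.update_self, Finset.prod_eq_one, mul_one]
  intro k hk
  rw [Function.update_of_ne (Finset.ne_of_mem_erase hk)]
  by_cases hki : k = i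
  · subst hki; simp [hA]
  · rw [hA, Function.update_of_ne hki]
    exact h.normalized

end Trial

/-- A symmetric double sum is its diagonal plus twice its upper triangle. -/
theorem sum_sum_eq_diag_add_two_mul {N : ℕ} (f : Fin N → Fin N → ℝ) (hf : ∀ i j, f i j = f j i) :
    ∑ i, ∑ j, f i j = ∑ i, f i i + 2 * ∑ i, ∑ j ∈ Finset.Ioi i, f i j := by
  have h1 : ∀ i, ∑ j, f i j = f i i + ∑ j ∈ Finset.Ioi i, f i j + ∑ j ∈ Finset.Iio i, f i j := by
    intro i
    have : (Finset.univ : Finset (Fin N)) = insert i (Finset.Ioi i ∪ Finset.Iio i) := by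
      ext j; simp; grind
    rw [this, Finset.sum_insert (by simp), Finset.sum_union, add_assoc]
    exact Finset.disjoint_left.2 fun j hj hj' => by
      simp at hj hj'; exact absurd hj (not_lt.2 hj'.le)
  have h2 : ∑ i, ∑ j ∈ Finset.Iio i, f i j = ∑ i, ∑ j ∈ Finset.Ioi i, f i j := by
    rw [Finset.sum_comm' (t' := Finset.univ) (s' := fun j => Finset.Ioi j) (by simp)]
    exact Finset.sum_congr rfl fun i _ => Finset.sum_congr rfl fun j _ => hf _ _
  simp only [h1, Finset.sum_add_distrib, h2]
  ring

/-- The number of pairs `i < j` is `(N² - N) / 2`. -/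
theorem sum_card_Ioi_eq (N : ℕ) :
    (N : ℝ) ^ 2 = N + 2 * ∑ i : Fin N, ((Finset.Ioi i).card : ℝ) := by
  have := sum_sum_eq_diag_add_two_mul (N := N) (fun _ _ => 1) fun _ _ => rfl
  simp only [Finset.sum_const, Finset.card_univ, Fintype.card_fin, nsmul_eq_mul, mul_one] at this
  rw [← this, sq]

theorem manyBodyForm_nonneg {N : ℕ} (V : Potential) {γ : ℝ} (hγ : 0 ≤ γ)
    (G : Fin N → (Fin N → ℝ) → ℂ) : 0 ≤ manyBodyForm V γ G := by
  unfold manyBodyForm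
  refine add_nonneg (Finset.sum_nonneg fun i _ => add_nonneg ?_ ?_)
    (mul_nonneg (by positivity) (Finset.sum_nonneg fun i _ => Finset.sum_nonneg fun j _ => ?_))
  all_goals exact integral_nonneg fun _ => by positivity

/-- The product state shows that the energy per particle is at most the Gross-Pitaevskii energy. -/
theorem groundStateEnergy_le (N : ℕ) (V : Potential) {γ : ℝ} (hγ : 0 ≤ γ) {ψ dψ : ℝ → ℂ}
    (h : IsAdmissible V ψ dψ) : groundStateEnergy N V γ ≤ N * gpFunctional V γ ψ dψ := by
  have hle : groundStateEnergy N V γ ≤ manyBodyForm V γ (productGrad ψ dψ N) :=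
    csInf_le ⟨0, by rintro _ ⟨Ψ, G, -, rfl⟩; exact manyBodyForm_nonneg V hγ G⟩
      ⟨_, _, isBosonicAdmissible_productState h, rfl⟩
  refine hle.trans ?_
  unfold manyBodyForm
  simp only [integral_normSq_productGrad h, integral_potential_productGrad h]
  have hint : ∀ i : Fin N, ∑ j ∈ Finset.Ioi i,
      ∫ z, ‖lineValue (productGrad ψ dψ N) i z (z j)‖ ^ 2 ∂cube N
      = (Finset.Ioi i).card * ∫ x, ‖ψ x‖ ^ 4 ∂unitMeasure := by
    intro i
    rw [Finset.sum_congr rfl fun j hj => integral_interaction_productGrad h (Finset.mem_Ioi.1 hj).ne,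
      Finset.sum_const, nsmul_eq_mul]
  simp only [hint]
  rw [← Finset.sum_mul, Finset.sum_const, Finset.card_univ, Fintype.card_fin, nsmul_eq_mul]
  have hc := sum_card_Ioi_eq N
  have hD : 0 ≤ ∫ x, ‖ψ x‖ ^ 4 ∂unitMeasure := integral_nonneg fun _ => by positivity
  change _ ≤ (N : ℝ) * ((∫ x, ‖dψ x‖ ^ 2 ∂unitMeasure) + (∫ x, ‖ψ x‖ ^ 2 ∂V.measure)
    + γ / 2 * ∫ x, ‖ψ x‖ ^ 4 ∂unitMeasure)
  rcases Nat.eq_zero_or_pos N with rfl | hN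
  · simp
  have hN' : (0 : ℝ) < N := by exact_mod_cast hN
  have : γ / N * ((∑ i : Fin N, ((Finset.Ioi i).card : ℝ)) * ∫ x, ‖ψ x‖ ^ 4 ∂unitMeasure)
      ≤ N * (γ / 2 * ∫ x, ‖ψ x‖ ^ 4 ∂unitMeasure) := by
    have h1 : ∑ i : Fin N, ((Finset.Ioi i).card : ℝ) ≤ (N : ℝ) ^ 2 / 2 := by linarith
    calc _ ≤ γ / N * ((N : ℝ) ^ 2 / 2 * ∫ x, ‖ψ x‖ ^ 4 ∂unitMeasure) := by gcongr
      _ = _ := by field_simp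
  linarith

/-! ### The exponential kernel -/

/-- The exponential kernel is positive definite: `exp (-|x - y| / R)` is the inner product in `L²(ℝ)`
of the one-sided exponentials `s ↦ √(2/R) exp ((s - x) / R)`, `s ≤ x`, attached to `x` and `y`. -/
theorem exists_feature_map {R : ℝ} (hR : 0 < R) :
    ∃ Φ : ℝ → Lp ℝ 2 (volume : Measure ℝ), Continuous Φ ∧
      ∀ x y, inner ℝ (Φ x) (Φ y) = expKernel R x y := by
  set k : ℝ → ℝ → ℝ := fun x => (Iic x).indicator fun s => Real.sqrt (2 / R) * Real.exp ((s - x) / R)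
    with hk
  have hmul : ∀ x y s, k x s * k y s
      = (Iic (min x y)).indicator (fun s => 2 / R * Real.exp (-(x + y) / R) * Real.exp (2 / R * s)) s := by
    intro x y s
    simp only [hk, indicator_apply, mem_Iic, le_min_iff]
    by_cases h1 : s ≤ x <;> by_cases h2 : s ≤ y <;> simp [h1, h2]
    have h3 : Real.sqrt (2 / R) * Real.sqrt (2 / R) = 2 / R := Real.mul_self_sqrt (by positivity)
    have h4 : Real.exp ((s - x) / R) * Real.exp ((s - y) / R)
        = Real.exp (-(x + y) / R) * Real.exp (2 / R * s) := by
      rw [← Real.exp_add, ← Real.exp_add]; congr 1; field_simp; ring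
    calc _ = Real.sqrt (2 / R) * Real.sqrt (2 / R)
          * (Real.exp ((s - x) / R) * Real.exp ((s - y) / R)) := by
            simp only [Real.sqrt_div zero_le_two]; ring
      _ = 2 / R * (Real.exp (-(x + y) / R) * Real.exp (2 / R * s)) := by rw [h3, h4]
      _ = _ := by rw [neg_add]; ring_nf
  have hmeas : ∀ x, Measurable (k x) := fun x =>
    Measurable.indicator (by fun_prop) measurableSet_Iic
  have hR2 : 0 < 2 / R := by positivity
  have hkmem : ∀ x, MemLp (k x) 2 volume := by
    intro x
    refine (memLp_two_iff_integrable_sq (hmeas x).aestronglyMeasurable).2 ?_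
    have e : (fun s => k x s ^ 2) = (Iic (min x x)).indicator
        (fun s => 2 / R * Real.exp (-(x + x) / R) * Real.exp (2 / R * s)) := by
      funext s; rw [sq, hmul]
    rw [e, integrable_indicator_iff measurableSet_Iic]
    exact (integrableOn_exp_mul_Iic hR2 _).const_mul _
  have hin : ∀ x y, inner ℝ ((hkmem x).toLp (k x)) ((hkmem y).toLp (k y)) = expKernel R x y := by
    intro x y
    rw [L2.inner_def]
    have e : ∫ s, inner ℝ ((hkmem x).toLp (k x) s) ((hkmem y).toLp (k y) s) = ∫ s, k x s * k y s := by
      refine integral_congr_ae ?_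
      filter_upwards [(hkmem x).coeFn_toLp, (hkmem y).coeFn_toLp] with s h1 h2
      rw [h1, h2, real_inner_eq_re_inner]; simp [mul_comm]
    rw [e]
    simp only [hmul]
    rw [integral_indicator measurableSet_Iic, integral_const_mul, integral_exp_mul_Iic hR2, expKernel]
    have : -(|x - y| / R) = -(x + y) / R + 2 / R * min x y := by
      rcases le_total x y with h | h
      · rw [min_eq_left h, abs_of_nonpos (by linarith)]; field_simp; ring
      · rw [min_eq_right h, abs_of_nonneg (by linarith)]; field_simp; ring
    rw [this, Real.exp_add]
    field_simp
  refine ⟨fun x => (hkmem x).toLp (k x), ?_, hin⟩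
  rw [continuous_iff_continuousAt]
  intro x
  rw [ContinuousAt, tendsto_iff_norm_sub_tendsto_zero]
  have h1 : ∀ y, ‖(hkmem y).toLp (k y) - (hkmem x).toLp (k x)‖
      = Real.sqrt (2 - 2 * expKernel R y x) := by
    intro y
    rw [norm_eq_sqrt_real_inner, inner_sub_left, inner_sub_right, inner_sub_right, hin, hin, hin, hin,
      expKernel_self, expKernel_self, expKernel_comm R x y]
    congr 1; ring
  simp only [h1]
  have hc : Continuous fun y => Real.sqrt (2 - 2 * expKernel R y x) := by
    unfold expKernel; fun_prop
  have := hc.tendsto x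
  simpa [expKernel_self] using this

theorem integral_expKernel_le {R : ℝ} (hR : 0 < R) {x : ℝ} (hx : x ∈ Icc (0 : ℝ) 1) :
    ∫ y, expKernel R x y ∂unitMeasure ≤ 2 * R := by
  have hc : Continuous fun y => expKernel R x y := by unfold expKernel; fun_prop
  rw [integral_unit_eq_intervalIntegral, ← intervalIntegral.integral_add_adjacent_intervals
    (b := x) (hc.intervalIntegrable _ _) (hc.intervalIntegrable _ _)]
  have hL : ∫ y in (0 : ℝ)..x, expKernel R x y ≤ R := by
    have : ∫ y in (0 : ℝ)..x, expKernel R x y = ∫ y in (0 : ℝ)..x, Real.exp ((y - x) / R) := by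
      refine intervalIntegral.integral_congr fun y hy => ?_
      rw [uIcc_of_le hx.1] at hy
      simp only [expKernel]
      rw [abs_of_nonneg (by linarith [hy.2])]; congr 1; ring
    rw [this, intervalIntegral.integral_eq_sub_of_hasDerivAt
      (f := fun y => R * Real.exp ((y - x) / R)) (fun y _ => ?_)
      ((by fun_prop : Continuous fun y => Real.exp ((y - x) / R)).intervalIntegrable _ _)]
    · have := Real.exp_pos ((0 - x) / R)
      simp only [sub_self, zero_div, Real.exp_zero, mul_one]
      nlinarith
    · have := ((((hasDerivAt_id y).sub_const x).div_const R).exp).const_mul R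
      convert! this using 1
      simp only [id]; field_simp
  have hU : ∫ y in x..1, expKernel R x y ≤ R := by
    have : ∫ y in x..1, expKernel R x y = ∫ y in x..1, Real.exp (-((y - x) / R)) := by
      refine intervalIntegral.integral_congr fun y hy => ?_
      rw [uIcc_of_le hx.2] at hy
      simp only [expKernel]
      rw [abs_of_nonpos (by linarith [hy.1])]; congr 1; ring
    rw [this, intervalIntegral.integral_eq_sub_of_hasDerivAt
      (f := fun y => -R * Real.exp (-((y - x) / R))) (fun y _ => ?_)
      ((by fun_prop : Continuous fun y => Real.exp (-((y - x) / R))).intervalIntegrable _ _)]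
    · have := Real.exp_pos (-((1 - x) / R))
      simp only [sub_self, zero_div, neg_zero, Real.exp_zero, mul_one]
      nlinarith
    · have := ((((hasDerivAt_id y).sub_const x).div_const R).neg.exp).const_mul (-R)
      convert! this using 1
      simp only [id, Pi.neg_apply]; field_simp
  linarith

/-- The convolution of a density on the unit interval with the exponential kernel. -/
noncomputable def expConv (R : ℝ) (ρ : ℝ → ℝ) (x : ℝ) : ℝ := ∫ y, expKernel R x y * ρ y ∂unitMeasure

section

variable {R : ℝ} {ρ σ : ℝ → ℝ}

theorem integrable_expKernel_mul (hR : 0 < R) (hρ : Integrable ρ unitMeasure) (x : ℝ) :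
    Integrable (fun y => expKernel R x y * ρ y) unitMeasure := by
  refine hρ.bdd_mul (c := 1) ?_ (Eventually.of_forall fun y => ?_)
  · exact (by unfold expKernel; fun_prop : Continuous fun y => expKernel R x y).aestronglyMeasurable
  · rw [Real.norm_eq_abs, abs_of_nonneg (expKernel_nonneg _ _ _)]
    exact expKernel_le_one hR x y

theorem abs_expConv_le (hR : 0 < R) (hρ : Integrable ρ unitMeasure) (x : ℝ) :
    |expConv R ρ x| ≤ ∫ y, |ρ y| ∂unitMeasure := by
  refine abs_integral_le_integral_abs.trans
    (integral_mono (integrable_expKernel_mul hR hρ x).abs hρ.abs fun y => ?_)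
  simp only [abs_mul, abs_of_nonneg (expKernel_nonneg R x y)]
  exact mul_le_of_le_one_left (abs_nonneg _) (expKernel_le_one hR x y)

theorem continuous_expConv (hR : 0 < R) (hρ : Integrable ρ unitMeasure) :
    Continuous (expConv R ρ) := by
  refine continuous_of_dominated (bound := fun y => |ρ y|)
    (fun x => (integrable_expKernel_mul hR hρ x).1) (fun x => Eventually.of_forall fun y => ?_)
    hρ.abs (Eventually.of_forall fun y => ?_)
  · rw [Real.norm_eq_abs, abs_mul, abs_of_nonneg (expKernel_nonneg R x y)]
    exact mul_le_of_le_one_left (abs_nonneg _) (expKernel_le_one hR x y)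
  · unfold expKernel; fun_prop

theorem integrable_mul_expConv (hR : 0 < R) (hρ : Integrable ρ unitMeasure)
    (hσ : Integrable σ unitMeasure) : Integrable (fun x => σ x * expConv R ρ x) unitMeasure := by
  refine hσ.mul_bdd (c := ∫ y, |ρ y| ∂unitMeasure)
    (continuous_expConv hR hρ).aestronglyMeasurable (Eventually.of_forall fun x => ?_)
  exact abs_expConv_le hR hρ x

theorem integral_mul_expConv_comm (hR : 0 < R) (hρ : Integrable ρ unitMeasure)
    (hσ : Integrable σ unitMeasure) :
    ∫ x, σ x * expConv R ρ x ∂unitMeasure = ∫ x, ρ x * expConv R σ x ∂unitMeasure := by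
  simp only [expConv, ← integral_const_mul]
  rw [integral_integral_swap]
  · refine integral_congr_ae (Eventually.of_forall fun y => ?_)
    refine integral_congr_ae (Eventually.of_forall fun x => ?_)
    simp only
    rw [expKernel_comm R x y]; ring
  · have h := (hσ.mul_prod hρ).bdd_mul (c := 1) (f := fun p => expKernel R p.1 p.2)
      (continuous_expKernel R).aestronglyMeasurable (Eventually.of_forall fun p => by
        rw [Real.norm_eq_abs, abs_of_nonneg (expKernel_nonneg _ _ _)]
        exact expKernel_le_one hR _ _)
    refine h.congr (Eventually.of_forall fun p => ?_)
    simp only [Function.uncurry]; ring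

theorem expConv_mono (hR : 0 < R) (hρ : Integrable ρ unitMeasure) (hσ : Integrable σ unitMeasure)
    (h : ∀ᵐ x ∂unitMeasure, ρ x ≤ σ x) (x : ℝ) : expConv R ρ x ≤ expConv R σ x := by
  refine integral_mono_ae (integrable_expKernel_mul hR hρ x) (integrable_expKernel_mul hR hσ x) ?_
  filter_upwards [h] with y hy
  exact mul_le_mul_of_nonneg_left hy (expKernel_nonneg _ _ _)

theorem expConv_const_le (hR : 0 < R) {M : ℝ} (hM : 0 ≤ M) {x : ℝ} (hx : x ∈ Icc (0 : ℝ) 1) :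
    expConv R (fun _ => M) x ≤ 2 * R * M := by
  rw [expConv, integral_mul_const]
  exact mul_le_mul_of_nonneg_right (integral_expKernel_le hR hx) hM

/-- Young's inequality `⟨ρ, w * ρ⟩ ≤ ‖w‖₁ ‖ρ‖₂²` for the exponential kernel. -/
theorem integral_mul_expConv_self_le (hR : 0 < R) (hρ : Integrable ρ unitMeasure)
    (hρ2 : Integrable (fun x => ρ x ^ 2) unitMeasure) :
    ∫ x, ρ x * expConv R ρ x ∂unitMeasure ≤ 2 * R * ∫ x, ρ x ^ 2 ∂unitMeasure := by
  have h1 : Integrable (fun _ : ℝ => (1 : ℝ)) unitMeasure := integrable_const 1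
  have hone : ∫ x, ρ x ^ 2 * expConv R (fun _ => 1) x ∂unitMeasure
      ≤ 2 * R * ∫ x, ρ x ^ 2 ∂unitMeasure := by
    rw [← integral_const_mul]
    refine integral_mono_ae (integrable_mul_expConv hR h1 hρ2) (hρ2.const_mul _) ?_
    filter_upwards [ae_restrict_mem measurableSet_Icc] with x hx
    have := expConv_const_le hR zero_le_one hx
    nlinarith [sq_nonneg (ρ x)]
  -- `2 ρ(x) ρ(y) ≤ ρ(x)² + ρ(y)²` inside the double integral
  have hpt : ∀ x, ρ x * expConv R ρ x
      ≤ (ρ x ^ 2 * expConv R (fun _ => 1) x + 1 * expConv R (fun y => ρ y ^ 2) x) / 2 := by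
    intro x
    rw [one_mul]
    simp only [expConv]
    rw [← integral_const_mul, ← integral_const_mul, ← integral_add
      ((integrable_expKernel_mul hR h1 x).const_mul _) (integrable_expKernel_mul hR hρ2 x),
      ← integral_div]
    refine integral_mono ((integrable_expKernel_mul hR hρ x).const_mul _)
      ((((integrable_expKernel_mul hR h1 x).const_mul _).add
        (integrable_expKernel_mul hR hρ2 x)).div_const 2) fun y => ?_
    have := mul_nonneg (expKernel_nonneg R x y) (sq_nonneg (ρ x - ρ y))
    simp only
    nlinarith
  calc _ ≤ ∫ x, (ρ x ^ 2 * expConv R (fun _ => 1) x + 1 * expConv R (fun y => ρ y ^ 2) x) / 2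
        ∂unitMeasure := integral_mono (integrable_mul_expConv hR hρ hρ)
          (((integrable_mul_expConv hR h1 hρ2).add (integrable_mul_expConv hR hρ2 h1)).div_const 2) hpt
    _ = ∫ x, ρ x ^ 2 * expConv R (fun _ => 1) x ∂unitMeasure := by
        rw [integral_div, integral_add (integrable_mul_expConv hR h1 hρ2)
          (integrable_mul_expConv hR hρ2 h1), integral_mul_expConv_comm hR hρ2 h1]
        ring
    _ ≤ _ := hone

/-- Positive definiteness of the exponential kernel, tested with the measure `∑ᵢ δ(zᵢ) - N ρ`. -/
theorem sum_expKernel_lower_bound (hR : 0 < R) (hρ : Integrable ρ unitMeasure) {N : ℕ}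
    (z : Fin N → ℝ) :
    N * ∑ i, expConv R ρ (z i) - (N : ℝ) ^ 2 / 2 * (∫ x, ρ x * expConv R ρ x ∂unitMeasure) - N / 2
      ≤ ∑ i, ∑ j ∈ Finset.Ioi i, expKernel R (z i) (z j) := by
  obtain ⟨Φ, hΦc, hΦ⟩ := exists_feature_map hR
  have hΦn : ∀ x, ‖Φ x‖ = 1 := by
    intro x
    have h := real_inner_self_eq_norm_sq (Φ x)
    rw [hΦ, expKernel_self] at h
    exact (pow_eq_one_iff_of_nonneg (norm_nonneg _) two_ne_zero).1 h.symm
  have hint : Integrable (fun x => ρ x • Φ x) unitMeasure := by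
    refine hρ.mono (hρ.1.smul hΦc.aestronglyMeasurable) (Eventually.of_forall fun x => ?_)
    rw [norm_smul, hΦn, mul_one]
  set m := ∫ x, ρ x • Φ x ∂unitMeasure with hm
  have h1 : ∀ x, inner ℝ (Φ x) m = expConv R ρ x := by
    intro x
    rw [hm, ← integral_inner hint, expConv]
    refine integral_congr_ae (Eventually.of_forall fun y => ?_)
    simp only [inner_smul_right, hΦ]; ring
  have h2 : inner ℝ m m = ∫ x, ρ x * expConv R ρ x ∂unitMeasure := by
    nth_rewrite 2 [hm]
    rw [← integral_inner hint]
    refine integral_congr_ae (Eventually.of_forall fun y => ?_)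
    simp only [inner_smul_right]
    rw [real_inner_comm, h1]
  have h3 : 0 ≤ inner ℝ (∑ i, Φ (z i) - (N : ℝ) • m) (∑ i, Φ (z i) - (N : ℝ) • m) :=
    real_inner_self_nonneg
  rw [inner_sub_left, inner_sub_right, inner_sub_right, inner_smul_left, inner_smul_right,
    inner_smul_right, inner_smul_left, real_inner_comm (∑ i, Φ (z i)) m, h2, sum_inner, sum_inner] at h3
  simp only [inner_sum, hΦ, h1] at h3
  rw [sum_sum_eq_diag_add_two_mul _ fun i j => expKernel_comm R (z i) (z j)] at h3
  simp only [expKernel_self, Finset.sum_const, Finset.card_univ, Fintype.card_fin, nsmul_eq_mul,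
    mul_one, RCLike.conj_to_real] at h3
  nlinarith

end

/-! ### One-particle estimates -/

section

variable {f df : ℝ → ℂ} {R : ℝ}

/-- Poincaré's inequality, with a non-optimal constant. -/
theorem IsH01.integral_normSq_le (h : IsH01 f df) :
    ∫ x, ‖f x‖ ^ 2 ∂unitMeasure ≤ 4 * ∫ x, ‖df x‖ ^ 2 ∂unitMeasure := by
  have : ∫ x, ‖f x‖ ^ 2 ∂unitMeasure
      ≤ ∫ _, (1 / 2 * (∫ x, ‖f x‖ ^ 2 ∂unitMeasure) + (1 / 2)⁻¹ * ∫ x, ‖df x‖ ^ 2 ∂unitMeasure)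
        ∂unitMeasure := by
    refine integral_mono_ae h.integrable_normSq (integrable_const _) ?_
    filter_upwards [ae_restrict_mem measurableSet_Icc] with x hx
    exact normSq_le_of_primitive h.memLp h.eq_integral (by norm_num) hx
  rw [integral_const] at this
  simp only [probReal_univ, one_smul] at this
  linarith

/-- Replacing a density `ρ ≤ M` by its average over the range `R` lowers its expectation value in the
state `f` by at most a multiple of `R M ‖f‖₂ ‖f'‖₂`. -/
theorem IsH01.integral_mul_normSq_le (h : IsH01 f df) (hR : 0 < R) {ρ : ℝ → ℝ}
    (hρ : ContinuousOn ρ (Icc 0 1)) (hρ0 : ∀ x ∈ Icc (0 : ℝ) 1, 0 ≤ ρ x) {M : ℝ}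
    (hM : ∀ x ∈ Icc (0 : ℝ) 1, ρ x ≤ M) {s : ℝ} (hs : 0 < s) :
    ∫ x, ρ x * ‖f x‖ ^ 2 ∂unitMeasure
      ≤ (2 * R)⁻¹ * (∫ x, expConv R ρ x * ‖f x‖ ^ 2 ∂unitMeasure)
        + R * M * (s * (∫ x, ‖f x‖ ^ 2 ∂unitMeasure) + s⁻¹ * ∫ x, ‖df x‖ ^ 2 ∂unitMeasure) := by
  have hM0 : 0 ≤ M := (hρ0 0 (by simp)).trans (hM 0 (by simp))
  have hρi : Integrable ρ unitMeasure := hρ.integrableOn_compact isCompact_Icc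
  have hb := integrable_norm_mul_norm h.memLp h.eq_integral
  set a : ℝ → ℝ := fun x => ‖f x‖ ^ 2 with ha
  set b : ℝ → ℝ := fun x => ‖f x‖ * ‖df x‖ with hbd
  have hai : Integrable a unitMeasure := h.integrable_normSq
  have e1 : ∫ x, ρ x * a x ∂unitMeasure
      ≤ ∫ x, ((2 * R)⁻¹ * (ρ x * expConv R a x) + ρ x * expConv R b x) ∂unitMeasure := by
    refine integral_mono_ae ((hρ.mul (h.continuousOn.norm.pow 2)).integrableOn_compact isCompact_Icc)
      (((integrable_mul_expConv hR hai hρi).const_mul _).add (integrable_mul_expConv hR hb hρi)) ?_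
    filter_upwards [ae_restrict_mem measurableSet_Icc] with y hy
    have h1 := abs_normSq_sub_average_le h.memLp h.eq_integral h.right_eq_zero hR hy
    have h2 := (le_abs_self _).trans h1
    have h3 : a y ≤ (2 * R)⁻¹ * expConv R a y + expConv R b y := by
      simp only [expConv, expKernel_comm R y]
      linarith
    calc ρ y * a y ≤ ρ y * ((2 * R)⁻¹ * expConv R a y + expConv R b y) :=
          mul_le_mul_of_nonneg_left h3 (hρ0 y hy)
      _ = _ := by ring
  rw [integral_add ((integrable_mul_expConv hR hai hρi).const_mul _)
    (integrable_mul_expConv hR hb hρi), integral_const_mul,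
    integral_mul_expConv_comm hR hai hρi, integral_mul_expConv_comm hR hb hρi] at e1
  have e2 : ∫ x, b x * expConv R ρ x ∂unitMeasure
      ≤ ∫ x, R * M * (s * a x + s⁻¹ * ‖df x‖ ^ 2) ∂unitMeasure := by
    refine integral_mono_ae (integrable_mul_expConv hR hρi hb)
      (((hai.const_mul s).add (h.integrable_normSq_deriv.const_mul _)).const_mul _) ?_
    filter_upwards [ae_restrict_mem measurableSet_Icc] with x hx
    have h1 : expConv R ρ x ≤ 2 * R * M :=
      (expConv_mono hR hρi (integrable_const M) (by
        filter_upwards [ae_restrict_mem measurableSet_Icc] with y hy using hM y hy) x).trans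
        (expConv_const_le hR hM0 hx)
    have h2 : 0 ≤ s⁻¹ * (s * ‖f x‖ - ‖df x‖) ^ 2 := by positivity
    have h3 : s⁻¹ * (s * ‖f x‖ - ‖df x‖) ^ 2
        = s * ‖f x‖ ^ 2 + s⁻¹ * ‖df x‖ ^ 2 - 2 * (‖f x‖ * ‖df x‖) := by
      field_simp; ring
    calc b x * expConv R ρ x ≤ b x * (2 * R * M) :=
          mul_le_mul_of_nonneg_left h1 (by positivity)
      _ = R * M * (2 * (‖f x‖ * ‖df x‖)) := by simp only [hbd]; ring
      _ ≤ R * M * (s * a x + s⁻¹ * ‖df x‖ ^ 2) := by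
          refine mul_le_mul_of_nonneg_left ?_ (by positivity)
          simp only [ha]; linarith
  rw [integral_const_mul, integral_add (hai.const_mul s) (h.integrable_normSq_deriv.const_mul _),
    integral_const_mul, integral_const_mul] at e2
  simp only [mul_comm (expConv R ρ _)]
  linarith

/-- The delta interaction at `y`, helped by a part `ε` of the kinetic energy, dominates its
regularization by the exponential kernel of range `R`, up to the relative error `θ = γ R / (2 ε)`. -/
theorem IsH01.regularized_delta_le (h : IsH01 f df) (hR : 0 < R) {γ ε θ : ℝ} (hγ : 0 ≤ γ)
    (hε : 0 ≤ ε) (hrel : γ * R = 2 * ε * θ) {y : ℝ} (hy : y ∈ Icc (0 : ℝ) 1) :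
    γ * (1 - θ) * ((2 * R)⁻¹ * ∫ x, expKernel R x y * ‖f x‖ ^ 2 ∂unitMeasure)
      ≤ γ * ‖f y‖ ^ 2 + ε * ∫ x, ‖df x‖ ^ 2 ∂unitMeasure := by
  have hEc : Continuous fun x => expKernel R x y := by unfold expKernel; fun_prop
  have iE : Integrable (fun x => expKernel R x y * ‖f x‖ ^ 2) unitMeasure := by
    simpa only [expKernel_comm R y] using integrable_expKernel_mul hR h.integrable_normSq y
  have iB : Integrable (fun x => expKernel R x y * (‖f x‖ * ‖df x‖)) unitMeasure := by
    simpa only [expKernel_comm R y] using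
      integrable_expKernel_mul hR (integrable_norm_mul_norm h.memLp h.eq_integral) y
  have h1 := (neg_le_abs _).trans
    (abs_normSq_sub_average_le h.memLp h.eq_integral h.right_eq_zero hR hy)
  have h2 : γ * ∫ x, expKernel R x y * (‖f x‖ * ‖df x‖) ∂unitMeasure
      ≤ ε * (∫ x, ‖df x‖ ^ 2 ∂unitMeasure)
        + γ * θ * ((2 * R)⁻¹ * ∫ x, expKernel R x y * ‖f x‖ ^ 2 ∂unitMeasure) := by
    rw [← integral_const_mul, ← integral_const_mul, ← integral_const_mul, ← integral_const_mul,
      ← integral_add (h.integrable_normSq_deriv.const_mul _) ((iE.const_mul _).const_mul _)]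
    refine integral_mono (iB.const_mul _)
      ((h.integrable_normSq_deriv.const_mul _).add ((iE.const_mul _).const_mul _)) fun x => ?_
    simp only
    set E := expKernel R x y
    have hE0 : 0 ≤ E := expKernel_nonneg _ _ _
    have hE1 : E ≤ 1 := expKernel_le_one hR _ _
    rcases hε.eq_or_lt with rfl | hε'
    · have : γ = 0 := by
        have : γ * R = 0 := by rw [hrel]; ring
        exact (mul_eq_zero.1 this).resolve_right hR.ne'
      simp [this]
    · have hθeq : θ = γ * R / (2 * ε) := by rw [hrel]; field_simp
      have h3 : 0 ≤ (2 * ε * ‖df x‖ - γ * E * ‖f x‖) ^ 2 + γ ^ 2 * (E * (1 - E)) * ‖f x‖ ^ 2 := by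
        have : 0 ≤ E * (1 - E) := mul_nonneg hE0 (by linarith)
        positivity
      -- completing the square; `E² ≤ E` leaves the nonnegative remainder `γ² E (1 - E) ‖f‖²`
      have h4 : 4 * ε * (ε * ‖df x‖ ^ 2 + γ * θ * ((2 * R)⁻¹ * (E * ‖f x‖ ^ 2))
          - γ * (E * (‖f x‖ * ‖df x‖)))
          = (2 * ε * ‖df x‖ - γ * E * ‖f x‖) ^ 2 + γ ^ 2 * (E * (1 - E)) * ‖f x‖ ^ 2 := by
        rw [hθeq]; field_simp; ring
      rw [← h4] at h3
      have := nonneg_of_mul_nonneg_right h3 (by positivity)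
      linarith
  have h5 := mul_le_mul_of_nonneg_left h1 hγ
  nlinarith

/-- The lower bound of `meanField_lower_bound_of_minimizer` without normalization. -/
theorem meanField_lower_bound (V : Potential) {γ : ℝ} (hγ : 0 ≤ γ)
    {ψ dψ : ℝ → ℂ} (hψ : IsAdmissible V ψ dψ)
    (hmin : ∀ φ dφ : ℝ → ℂ, IsAdmissible V φ dφ →
      gpFunctional V γ ψ dψ ≤ gpFunctional V γ φ dφ)
    (hf : IsH01 f df) (hV : Integrable (fun x => ‖f x‖ ^ 2) V.measure) :
    (gpFunctional V γ ψ dψ + γ / 2 * ∫ x, ‖ψ x‖ ^ 4 ∂unitMeasure) * ∫ x, ‖f x‖ ^ 2 ∂unitMeasure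
      ≤ (∫ x, ‖df x‖ ^ 2 ∂unitMeasure) + (∫ x, ‖f x‖ ^ 2 ∂V.measure)
        + γ * ∫ x, ‖ψ x‖ ^ 2 * ‖f x‖ ^ 2 ∂unitMeasure := by
  set m := ∫ x, ‖f x‖ ^ 2 ∂unitMeasure with hm
  have hm0 : 0 ≤ m := integral_nonneg fun _ => by positivity
  rcases hm0.eq_or_lt with h0 | hpos
  · rw [← h0, mul_zero]
    have h1 : 0 ≤ ∫ x, ‖df x‖ ^ 2 ∂unitMeasure := integral_nonneg fun _ => by positivity
    have h2 : 0 ≤ ∫ x, ‖f x‖ ^ 2 ∂V.measure := integral_nonneg fun _ => by positivity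
    have h3 : 0 ≤ ∫ x, ‖ψ x‖ ^ 2 * ‖f x‖ ^ 2 ∂unitMeasure := integral_nonneg fun _ => by positivity
    positivity
  · set c : ℂ := (((Real.sqrt m)⁻¹ : ℝ) : ℂ) with hc
    have hc2 : ‖c‖ ^ 2 = m⁻¹ := by
      rw [hc, Complex.norm_real, Real.norm_eq_abs, sq_abs, inv_pow, Real.sq_sqrt hpos.le]
    have hadm : IsAdmissible V (fun x => c * f x) (fun x => c * df x) :=
      ⟨hf.const_mul c, by simpa only [norm_mul, mul_pow] using hV.const_mul _, by
        simp only [norm_mul, mul_pow]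
        rw [integral_const_mul, hc2, ← hm, inv_mul_cancel₀ hpos.ne']⟩
    have h := meanField_lower_bound_of_minimizer V hψ hadm hmin
    simp only [norm_mul, mul_pow, hc2, mul_left_comm _ (m⁻¹)] at h
    rw [integral_const_mul, integral_const_mul, integral_const_mul] at h
    have h' := mul_le_mul_of_nonneg_right h hpos.le
    refine h'.trans (le_of_eq ?_)
    field_simp

end

/-! ### Slices of many-particle wave functions -/

section

variable {N : ℕ} {V : Potential} {Ψ : (Fin N → ℝ) → ℂ} {G : Fin N → (Fin N → ℝ) → ℂ}

theorem lineValue_update (G : Fin N → (Fin N → ℝ) → ℂ) (i : Fin N) (z : Fin N → ℝ) (s t : ℝ) :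
    lineValue G i (Function.update z i s) t = lineValue G i z t := by
  simp only [lineValue, Function.update_idem]

/-- Almost every slice of a many-particle wave function along a coordinate axis is in `H₀¹`. -/
theorem IsBosonicAdmissible.isH01_slice (h : IsBosonicAdmissible V Ψ G) (i : Fin N) :
    ∀ᵐ z ∂cube N, IsH01 (lineValue G i z) (fun t => G i (Function.update z i t)) := by
  have h2 : Integrable (fun z => ‖G i z‖ ^ 2) (cube N) := (h.memLp_grad i).norm.integrable_sq
  have hm : AEStronglyMeasurable (fun p : (Fin N → ℝ) × ℝ => G i (Function.update p.1 i p.2))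
      ((cube N).prod unitMeasure) :=
    (h.memLp_grad i).1.comp_measurePreserving (measurePreserving_update i)
  filter_upwards [h.lineValue_one i, (integrable_update i h2).prod_right_ae, hm.prodMk_left]
    with z h1 h2 h3
  exact ⟨(memLp_two_iff_integrable_sq_norm h3).2 h2, fun x _ => rfl, h1⟩

theorem IsBosonicAdmissible.eq_slice (h : IsBosonicAdmissible V Ψ G) (i : Fin N) :
    ∀ᵐ z ∂cube N, ∀ᵐ t ∂unitMeasure, Ψ (Function.update z i t) = lineValue G i z t := by
  filter_upwards [ae_ae_update i (h.eq_lineValue i)] with z hz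
  filter_upwards [hz] with t ht
  rw [ht, lineValue_update, Function.update_self]

theorem IsBosonicAdmissible.integrable_normSq (h : IsBosonicAdmissible V Ψ G) :
    Integrable (fun z => ‖Ψ z‖ ^ 2) (cube N) := h.memLp.norm.integrable_sq

section Weight

variable {m : (Fin N → ℝ) → ℝ} {C : ℝ}

theorem IsBosonicAdmissible.integrable_weight (h : IsBosonicAdmissible V Ψ G)
    (hm : AEStronglyMeasurable m (cube N)) (hC : ∀ᵐ z ∂cube N, |m z| ≤ C) :
    Integrable (fun z => m z * ‖Ψ z‖ ^ 2) (cube N) :=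
  h.integrable_normSq.bdd_mul hm hC

theorem IsBosonicAdmissible.slice_weight_ae_eq (h : IsBosonicAdmissible V Ψ G) (i : Fin N) :
    ∀ᵐ z ∂cube N, ∫ t, m (Function.update z i t) * ‖Ψ (Function.update z i t)‖ ^ 2 ∂unitMeasure
      = ∫ t, m (Function.update z i t) * ‖lineValue G i z t‖ ^ 2 ∂unitMeasure := by
  filter_upwards [h.eq_slice i] with z hz
  refine integral_congr_ae ?_
  filter_upwards [hz] with t ht
  rw [ht]

theorem IsBosonicAdmissible.integrable_slice_weight (h : IsBosonicAdmissible V Ψ G) (i : Fin N)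
    (hm : AEStronglyMeasurable m (cube N)) (hC : ∀ᵐ z ∂cube N, |m z| ≤ C) :
    Integrable (fun z => ∫ t, m (Function.update z i t) * ‖lineValue G i z t‖ ^ 2 ∂unitMeasure)
      (cube N) :=
  (integrable_update i (h.integrable_weight hm hC)).integral_prod_left.congr
    (h.slice_weight_ae_eq i)

theorem IsBosonicAdmissible.integral_slice_weight (h : IsBosonicAdmissible V Ψ G) (i : Fin N)
    (hm : AEStronglyMeasurable m (cube N)) (hC : ∀ᵐ z ∂cube N, |m z| ≤ C) :
    ∫ z, ∫ t, m (Function.update z i t) * ‖lineValue G i z t‖ ^ 2 ∂unitMeasure ∂cube N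
      = ∫ z, m z * ‖Ψ z‖ ^ 2 ∂cube N := by
  rw [integral_cube_eq_integral_update i (h.integrable_weight hm hC)]
  exact (integral_congr_ae (h.slice_weight_ae_eq i)).symm

end Weight

theorem IsBosonicAdmissible.integrable_slice_normSq (h : IsBosonicAdmissible V Ψ G) (i : Fin N) :
    Integrable (fun z => ∫ t, ‖lineValue G i z t‖ ^ 2 ∂unitMeasure) (cube N) := by
  simpa only [one_mul] using h.integrable_slice_weight i (m := fun _ => 1) (C := 1)
    aestronglyMeasurable_const (by simp)

theorem IsBosonicAdmissible.integral_slice_normSq (h : IsBosonicAdmissible V Ψ G) (i : Fin N) :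
    ∫ z, ∫ t, ‖lineValue G i z t‖ ^ 2 ∂unitMeasure ∂cube N = 1 := by
  have := h.integral_slice_weight i (m := fun _ => 1) (C := 1) aestronglyMeasurable_const (by simp)
  simp only [one_mul] at this
  rw [this, h.normalized]

theorem IsBosonicAdmissible.integrable_grad (h : IsBosonicAdmissible V Ψ G) (i : Fin N) :
    Integrable (fun z => ‖G i z‖ ^ 2) (cube N) := (h.memLp_grad i).norm.integrable_sq

theorem IsBosonicAdmissible.integrable_slice_grad (h : IsBosonicAdmissible V Ψ G) (i : Fin N) :
    Integrable (fun z => ∫ t, ‖G i (Function.update z i t)‖ ^ 2 ∂unitMeasure) (cube N) :=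
  (integrable_update i (h.integrable_grad i)).integral_prod_left

theorem IsBosonicAdmissible.integral_slice_grad (h : IsBosonicAdmissible V Ψ G) (i : Fin N) :
    ∫ z, ∫ t, ‖G i (Function.update z i t)‖ ^ 2 ∂unitMeasure ∂cube N = ∫ z, ‖G i z‖ ^ 2 ∂cube N :=
  (integral_cube_eq_integral_update i (h.integrable_grad i)).symm

theorem aestronglyMeasurable_comp_eval {ρ : ℝ → ℝ} (hρ : AEStronglyMeasurable ρ unitMeasure)
    (i : Fin N) : AEStronglyMeasurable (fun z => ρ (z i)) (cube N) := by
  rw [cube_eq_pi]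
  exact hρ.comp_quasiMeasurePreserving (Measure.quasiMeasurePreserving_eval _ i)

/-- The interaction integrals are finite: on almost every line the trace on `zᵢ = zⱼ` is controlled by
the `H¹` norm of the slice. -/
theorem IsBosonicAdmissible.integrable_trace (h : IsBosonicAdmissible V Ψ G) (i j : Fin N) :
    Integrable (fun z => ‖lineValue G i z (z j)‖ ^ 2) (cube N) := by
  refine ((h.integrable_slice_normSq i).add (h.integrable_slice_grad i)).mono' ?_ ?_
  · have hm : AEStronglyMeasurable (fun p : (Fin N → ℝ) × ℝ => G i (Function.update p.1 i p.2))
        ((cube N).prod unitMeasure) :=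
      (h.memLp_grad i).1.comp_measurePreserving (measurePreserving_update i)
    have hs : MeasurableSet {p : (Fin N → ℝ) × ℝ | p.2 ≤ p.1 j} :=
      measurableSet_le measurable_snd (by fun_prop)
    have h1 := (hm.indicator hs).integral_prod_right'
    refine (h1.congr ?_).norm.pow 2
    filter_upwards [ae_cube_mem_Icc N] with z hz
    have e : (fun t => {p : (Fin N → ℝ) × ℝ | p.2 ≤ p.1 j}.indicator
        (fun p : (Fin N → ℝ) × ℝ => G i (Function.update p.1 i p.2)) (z, t))
        = (Iic (z j)).indicator fun t => G i (Function.update z i t) := by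
      funext t; simp [indicator_apply]
    rw [e, integral_indicator measurableSet_Iic, unitMeasure,
      Measure.restrict_restrict measurableSet_Iic, lineValue,
      intervalIntegral.integral_of_le (hz j).1, ← integral_Icc_eq_integral_Ioc]
    congr 2
    ext t
    simp only [mem_inter_iff, mem_Iic, mem_Icc]
    constructor
    · rintro ⟨h1, h2, -⟩; exact ⟨h2, h1⟩
    · rintro ⟨h1, h2⟩; exact ⟨h2, h1, h2.trans (hz j).2⟩
  · filter_upwards [h.isH01_slice i, ae_cube_mem_Icc N] with z h1 h2
    rw [Real.norm_eq_abs, abs_of_nonneg (by positivity)]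
    simpa using normSq_le_of_primitive h1.memLp h1.eq_integral zero_lt_one (h2 j)

/-- The pair estimate: the delta interaction of the particles `i` and `j` and a part `ε` of the
kinetic energy of particle `i` dominate the regularized interaction. -/
theorem IsBosonicAdmissible.regularized_pair_le (h : IsBosonicAdmissible V Ψ G) {i j : Fin N}
    (hij : i ≠ j) {R : ℝ} (hR : 0 < R) {γ ε θ : ℝ} (hγ : 0 ≤ γ)
    (hε : 0 ≤ ε) (hrel : γ * R = 2 * ε * θ) :
    γ * (1 - θ) * ((2 * R)⁻¹ * ∫ z, expKernel R (z i) (z j) * ‖Ψ z‖ ^ 2 ∂cube N)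
      ≤ γ * (∫ z, ‖lineValue G i z (z j)‖ ^ 2 ∂cube N) + ε * ∫ z, ‖G i z‖ ^ 2 ∂cube N := by
  have hm : AEStronglyMeasurable (fun z : Fin N → ℝ => expKernel R (z i) (z j)) (cube N) :=
    (by unfold expKernel; fun_prop :
      Continuous fun z : Fin N → ℝ => expKernel R (z i) (z j)).aestronglyMeasurable
  have hC : ∀ᵐ z ∂cube N, |expKernel R (z i) (z j)| ≤ 1 := Eventually.of_forall fun z => by
    rw [abs_of_nonneg (expKernel_nonneg _ _ _)]; exact expKernel_le_one hR _ _
  have i1 := h.integrable_slice_weight i hm hC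
  rw [← h.integral_slice_weight i hm hC, ← h.integral_slice_grad i, ← integral_const_mul,
    ← integral_const_mul, ← integral_const_mul, ← integral_const_mul,
    ← integral_add ((h.integrable_trace i j).const_mul _) ((h.integrable_slice_grad i).const_mul _)]
  refine integral_mono_ae ((i1.const_mul _).const_mul _) (((h.integrable_trace i j).const_mul _).add
    ((h.integrable_slice_grad i).const_mul _)) ?_
  filter_upwards [h.isH01_slice i, ae_cube_mem_Icc N] with z h1 h2
  have := h1.regularized_delta_le hR hγ hε hrel (h2 j)
  simpa only [Function.update_self, Function.update_of_ne hij.symm] using this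

/-- The mean-field lower bound, applied to each particle with the others held fixed. -/
theorem IsBosonicAdmissible.meanField_lower_bound (h : IsBosonicAdmissible V Ψ G) (i : Fin N)
    {γ : ℝ} (hγ : 0 ≤ γ) {ψ dψ : ℝ → ℂ} (hψ : IsAdmissible V ψ dψ)
    (hmin : ∀ φ dφ : ℝ → ℂ, IsAdmissible V φ dφ →
      gpFunctional V γ ψ dψ ≤ gpFunctional V γ φ dφ) {M : ℝ}
    (hM : ∀ x ∈ Icc (0 : ℝ) 1, ‖ψ x‖ ^ 2 ≤ M) :
    gpFunctional V γ ψ dψ + γ / 2 * ∫ x, ‖ψ x‖ ^ 4 ∂unitMeasure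
      ≤ (∫ z, ‖G i z‖ ^ 2 ∂cube N)
        + (∫ p : (Fin N → ℝ) × ℝ, ‖lineValue G i p.1 p.2‖ ^ 2 ∂((cube N).prod V.measure))
        + γ * ∫ z, ‖ψ (z i)‖ ^ 2 * ‖Ψ z‖ ^ 2 ∂cube N := by
  have hm := aestronglyMeasurable_comp_eval (N := N) hψ.isH01.integrable_normSq.1 i
  have hC : ∀ᵐ z ∂cube N, |(‖ψ (z i)‖ ^ 2)| ≤ M := by
    filter_upwards [ae_cube_mem_Icc N] with z hz
    rw [abs_of_nonneg (by positivity)]; exact hM _ (hz i)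
  have i1 := h.integrable_slice_weight i hm hC
  have i2 := (h.integrable_potential i).integral_prod_left
  have hle : ∫ z, (gpFunctional V γ ψ dψ + γ / 2 * ∫ x, ‖ψ x‖ ^ 4 ∂unitMeasure)
        * (∫ t, ‖lineValue G i z t‖ ^ 2 ∂unitMeasure) ∂cube N
      ≤ ∫ z, ((∫ t, ‖G i (Function.update z i t)‖ ^ 2 ∂unitMeasure)
        + (∫ t, ‖lineValue G i z t‖ ^ 2 ∂V.measure)
        + γ * ∫ t, ‖ψ (Function.update z i t i)‖ ^ 2 * ‖lineValue G i z t‖ ^ 2 ∂unitMeasure) ∂cube N := by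
    refine integral_mono_ae ((h.integrable_slice_normSq i).const_mul _)
      (((h.integrable_slice_grad i).add i2).add (i1.const_mul _)) ?_
    filter_upwards [h.isH01_slice i, (h.integrable_potential i).prod_right_ae] with z h1 h2
    simpa only [Function.update_self] using LiebLiniger.meanField_lower_bound V hγ hψ hmin h1 h2
  have i3 : Integrable (fun z => (∫ t, ‖G i (Function.update z i t)‖ ^ 2 ∂unitMeasure)
        + ∫ t, ‖lineValue G i z t‖ ^ 2 ∂V.measure) (cube N) := (h.integrable_slice_grad i).add i2
  rw [integral_const_mul, h.integral_slice_normSq i, mul_one, integral_add i3 (i1.const_mul _),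
    integral_add (h.integrable_slice_grad i) i2, integral_const_mul, h.integral_slice_grad i,
    h.integral_slice_weight i hm hC] at hle
  rwa [integral_prod _ (h.integrable_potential i)]

/-- `IsH01.integral_mul_normSq_le` for one particle of a many-body state. -/
theorem IsBosonicAdmissible.integral_density_le (h : IsBosonicAdmissible V Ψ G) (i : Fin N)
    {R : ℝ} (hR : 0 < R) {ρ : ℝ → ℝ}
    (hρ : ContinuousOn ρ (Icc 0 1)) (hρ0 : ∀ x ∈ Icc (0 : ℝ) 1, 0 ≤ ρ x) {M : ℝ}
    (hM : ∀ x ∈ Icc (0 : ℝ) 1, ρ x ≤ M) {s : ℝ} (hs : 0 < s) :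
    ∫ z, ρ (z i) * ‖Ψ z‖ ^ 2 ∂cube N
      ≤ (2 * R)⁻¹ * (∫ z, expConv R ρ (z i) * ‖Ψ z‖ ^ 2 ∂cube N)
        + R * M * (s + s⁻¹ * ∫ z, ‖G i z‖ ^ 2 ∂cube N) := by
  have hρi : Integrable ρ unitMeasure := hρ.integrableOn_compact isCompact_Icc
  have hm := aestronglyMeasurable_comp_eval (N := N) hρi.1 i
  have hC : ∀ᵐ z ∂cube N, |ρ (z i)| ≤ M := by
    filter_upwards [ae_cube_mem_Icc N] with z hz
    rw [abs_of_nonneg (hρ0 _ (hz i))]; exact hM _ (hz i)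
  have hm' : AEStronglyMeasurable (fun z : Fin N → ℝ => expConv R ρ (z i)) (cube N) :=
    ((continuous_expConv hR hρi).comp (continuous_apply i)).aestronglyMeasurable
  have hC' : ∀ᵐ z ∂cube N, |expConv R ρ (z i)| ≤ ∫ y, |ρ y| ∂unitMeasure :=
    Eventually.of_forall fun z => abs_expConv_le hR hρi _
  have i1 := h.integrable_slice_weight i hm hC
  have i2 := h.integrable_slice_weight i hm' hC'
  have i3 : Integrable (fun z => s * (∫ t, ‖lineValue G i z t‖ ^ 2 ∂unitMeasure)
      + s⁻¹ * ∫ t, ‖G i (Function.update z i t)‖ ^ 2 ∂unitMeasure) (cube N) :=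
    ((h.integrable_slice_normSq i).const_mul _).add ((h.integrable_slice_grad i).const_mul _)
  have hle := integral_mono_ae i1 ((i2.const_mul (2 * R)⁻¹).add (i3.const_mul (R * M))) (by
    filter_upwards [h.isH01_slice i] with z h1
    simpa only [Function.update_self, Pi.add_apply] using h1.integral_mul_normSq_le hR hρ hρ0 hM hs)
  rw [h.integral_slice_weight i hm hC, integral_add' (i2.const_mul _) (i3.const_mul _),
    integral_const_mul, integral_const_mul, h.integral_slice_weight i hm' hC',
    integral_add ((h.integrable_slice_normSq i).const_mul _)
      ((h.integrable_slice_grad i).const_mul _), integral_const_mul, integral_const_mul,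
    h.integral_slice_normSq i, h.integral_slice_grad i, mul_one] at hle
  exact hle

/-- Positive definiteness of the exponential kernel reduces the regularized pair interaction to a
one-particle potential. -/
theorem IsBosonicAdmissible.sum_regularized_lower_bound (h : IsBosonicAdmissible V Ψ G)
    {R : ℝ} (hR : 0 < R) {ρ : ℝ → ℝ} (hρ : Integrable ρ unitMeasure) :
    N * ∑ i, (∫ z, expConv R ρ (z i) * ‖Ψ z‖ ^ 2 ∂cube N)
        - (N : ℝ) ^ 2 / 2 * (∫ x, ρ x * expConv R ρ x ∂unitMeasure) - N / 2
      ≤ ∑ i, ∑ j ∈ Finset.Ioi i, ∫ z, expKernel R (z i) (z j) * ‖Ψ z‖ ^ 2 ∂cube N := by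
  have i1 : ∀ i j, Integrable (fun z => expKernel R (z i) (z j) * ‖Ψ z‖ ^ 2) (cube N) := fun i j =>
    h.integrable_weight (C := 1) (by unfold expKernel; fun_prop :
      Continuous fun z : Fin N → ℝ => expKernel R (z i) (z j)).aestronglyMeasurable
      (Eventually.of_forall fun z => by
        rw [abs_of_nonneg (expKernel_nonneg _ _ _)]; exact expKernel_le_one hR _ _)
  have i2 : ∀ i, Integrable (fun z => expConv R ρ (z i) * ‖Ψ z‖ ^ 2) (cube N) := fun i =>
    h.integrable_weight
      ((continuous_expConv hR hρ).comp (continuous_apply i)).aestronglyMeasurable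
      (Eventually.of_forall fun z => abs_expConv_le hR hρ _)
  set D := ∫ x, ρ x * expConv R ρ x ∂unitMeasure
  have iL : Integrable (fun z => N * ∑ i, expConv R ρ (z i) * ‖Ψ z‖ ^ 2) (cube N) :=
    (integrable_finsetSum _ fun i _ => i2 i).const_mul _
  have iC : Integrable (fun z => ((N : ℝ) ^ 2 / 2 * D + N / 2) * ‖Ψ z‖ ^ 2) (cube N) :=
    h.integrable_normSq.const_mul _
  have hle : ∫ z, (N * ∑ i, expConv R ρ (z i) * ‖Ψ z‖ ^ 2
        - ((N : ℝ) ^ 2 / 2 * D + N / 2) * ‖Ψ z‖ ^ 2) ∂cube N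
      ≤ ∫ z, ∑ i, ∑ j ∈ Finset.Ioi i, expKernel R (z i) (z j) * ‖Ψ z‖ ^ 2 ∂cube N := by
    refine integral_mono (iL.sub iC)
      (integrable_finsetSum _ fun i _ => integrable_finsetSum _ fun j _ => i1 i j) fun z => ?_
    simp only [← Finset.sum_mul]
    have := mul_le_mul_of_nonneg_right (sum_expKernel_lower_bound hR hρ z) (sq_nonneg ‖Ψ z‖)
    linarith
  rw [integral_sub iL iC, integral_const_mul, integral_const_mul,
    integral_finsetSum _ fun i _ => i2 i, h.normalized,
    integral_finsetSum _ fun i _ => integrable_finsetSum _ fun j _ => i1 i j] at hle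
  simp only [integral_finsetSum _ fun j _ => i1 _ j] at hle
  linarith

end

/-! ### A priori bounds on minimizers -/

section

variable {V : Potential} {γ : ℝ} {ψ dψ : ℝ → ℂ}

theorem kinetic_le_gpFunctional (hγ : 0 ≤ γ) :
    ∫ x, ‖dψ x‖ ^ 2 ∂unitMeasure ≤ gpFunctional V γ ψ dψ := by
  have h2 : 0 ≤ ∫ x, ‖ψ x‖ ^ 2 ∂V.measure := integral_nonneg fun _ => by positivity
  have h3 : 0 ≤ ∫ x, ‖ψ x‖ ^ 4 ∂unitMeasure := integral_nonneg fun _ => by positivity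
  have : 0 ≤ γ / 2 * ∫ x, ‖ψ x‖ ^ 4 ∂unitMeasure := by positivity
  change _ ≤ (∫ x, ‖dψ x‖ ^ 2 ∂unitMeasure) + (∫ x, ‖ψ x‖ ^ 2 ∂V.measure)
    + γ / 2 * ∫ x, ‖ψ x‖ ^ 4 ∂unitMeasure
  linarith

theorem interaction_le_gpFunctional :
    γ / 2 * (∫ x, ‖ψ x‖ ^ 4 ∂unitMeasure) ≤ gpFunctional V γ ψ dψ := by
  have h1 : 0 ≤ ∫ x, ‖dψ x‖ ^ 2 ∂unitMeasure := integral_nonneg fun _ => by positivity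
  have h2 : 0 ≤ ∫ x, ‖ψ x‖ ^ 2 ∂V.measure := integral_nonneg fun _ => by positivity
  change _ ≤ (∫ x, ‖dψ x‖ ^ 2 ∂unitMeasure) + (∫ x, ‖ψ x‖ ^ 2 ∂V.measure)
    + γ / 2 * ∫ x, ‖ψ x‖ ^ 4 ∂unitMeasure
  linarith

theorem IsAdmissible.one_fourth_le (h : IsAdmissible V ψ dψ) (hγ : 0 ≤ γ) :
    1 / 4 ≤ gpFunctional V γ ψ dψ := by
  have h1 := h.isH01.integral_normSq_le
  rw [h.normalized] at h1
  linarith [kinetic_le_gpFunctional (V := V) (ψ := ψ) (dψ := dψ) hγ]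

/-- Jensen's inequality for the normalized density `‖ψ‖²`. -/
theorem IsAdmissible.one_le_integral_pow_four (h : IsAdmissible V ψ dψ) :
    1 ≤ ∫ x, ‖ψ x‖ ^ 4 ∂unitMeasure := by
  have i1 := h.isH01.integrable_pow_four
  have i2 := h.isH01.integrable_normSq
  have h0 : ∫ x, (2 * ‖ψ x‖ ^ 2 - 1) ∂unitMeasure ≤ ∫ x, ‖ψ x‖ ^ 4 ∂unitMeasure := by
    refine integral_mono ((i2.const_mul 2).sub (integrable_const 1)) i1 fun x => ?_
    simp only
    nlinarith [sq_nonneg (‖ψ x‖ ^ 2 - 1)]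
  rw [integral_sub (i2.const_mul 2) (integrable_const 1), integral_const_mul, h.normalized,
    integral_const] at h0
  simp only [probReal_univ, one_smul] at h0
  linarith

theorem IsAdmissible.normSq_le (h : IsAdmissible V ψ dψ) (hγ : 0 ≤ γ) {x : ℝ}
    (hx : x ∈ Icc (0 : ℝ) 1) : ‖ψ x‖ ^ 2 ≤ 2 * Real.sqrt (gpFunctional V γ ψ dψ) := by
  have he : 0 < gpFunctional V γ ψ dψ := by linarith [h.one_fourth_le hγ]
  have hs := Real.sqrt_pos.2 he
  have h1 := normSq_le_of_primitive h.isH01.memLp h.isH01.eq_integral hs hx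
  rw [h.normalized] at h1
  have h2 : (Real.sqrt (gpFunctional V γ ψ dψ))⁻¹ * (∫ x, ‖dψ x‖ ^ 2 ∂unitMeasure)
      ≤ (Real.sqrt (gpFunctional V γ ψ dψ))⁻¹ * gpFunctional V γ ψ dψ :=
    mul_le_mul_of_nonneg_left (kinetic_le_gpFunctional hγ) (by positivity)
  have h3 : (Real.sqrt (gpFunctional V γ ψ dψ))⁻¹ * gpFunctional V γ ψ dψ
      = Real.sqrt (gpFunctional V γ ψ dψ) := by
    rw [inv_mul_eq_div, Real.div_sqrt]
  linarith

end

/-! ### The lower bound -/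

/-- The bookkeeping of the lower bound. Here `T`, `W`, `J` stand for the kinetic, potential and
interaction energy, `S` for the regularized interaction, `Q` and `w P` for the expectation values of
the density `ρ` and of its average, `D` and `w D'` for the self-energies of `ρ` with the delta and the
regularized interaction. -/
theorem lower_bound_arithmetic {N T W J S P Q D D' e γ ε θ R : ℝ} (hN : 0 < N) (hγ : 0 ≤ γ)
    (he : 0 ≤ e) (hT : 0 ≤ T) (hW : 0 ≤ W) (hD0 : 0 ≤ D) (hε : 0 ≤ ε) (hε3 : 3 * ε ≤ 1)
    (hθ0 : 0 ≤ θ) (hθ1 : θ ≤ 1) (hR : 0 < R)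
    (hpair : γ * (1 - θ) * ((2 * R)⁻¹ * S) ≤ γ * J + ε * (N * T))
    (hpos : N * P - N ^ 2 / 2 * D' - N / 2 ≤ S)
    (hyoung : D' ≤ 2 * R * D)
    (hsmear : Q ≤ (2 * R)⁻¹ * P + 2 * R * (e * N + T))
    (hmf : N * (e + γ / 2 * D) ≤ T + W + γ * Q)
    (hDe : γ / 2 * D ≤ e) (hγR : γ * R ≤ ε)
    (hQ : γ * θ * Q ≤ 3 * ε * (γ * Q) + 2 * ε * (e * N))
    (hself : γ * ((2 * R)⁻¹ / 2) ≤ ε * (e * N)) :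
    N * e * (1 - 11 * ε) ≤ T + W + γ / N * J := by
  set w := (2 * R)⁻¹
  have hw0 : 0 < w := by positivity
  have hwR : w * (2 * R) = 1 := inv_mul_cancel₀ (by positivity)
  set a := γ * (1 - θ) with ha
  have ha0 : 0 ≤ a := mul_nonneg hγ (by linarith)
  have haγ : a ≤ γ := mul_le_of_le_one_right hγ (by linarith)
  have s1 : N * (w * P - N / 2 * D - w / 2) ≤ w * S := by
    have h1 : w * (N * P - N ^ 2 / 2 * (2 * R * D) - N / 2) ≤ w * S := by
      refine mul_le_mul_of_nonneg_left (le_trans ?_ hpos) hw0.le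
      have := mul_le_mul_of_nonneg_left hyoung (by positivity : 0 ≤ N ^ 2 / 2)
      linarith
    have h2 : w * (N * P - N ^ 2 / 2 * (2 * R * D) - N / 2)
        = N * (w * P - N / 2 * (w * (2 * R)) * D - w / 2) := by ring
    rwa [h2, hwR, mul_one] at h1
  have s2 : a * (w * P - N / 2 * D - w / 2) ≤ γ / N * J + ε * T := by
    have h1 := (mul_le_mul_of_nonneg_left s1 ha0).trans hpair
    have h2 : γ / N * J + ε * T = (γ * J + ε * (N * T)) / N := by field_simp
    rw [h2, le_div_iff₀ hN]
    linarith
  have s3 : a * (Q - 2 * R * (e * N + T) - N / 2 * D - w / 2)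
      ≤ a * (w * P - N / 2 * D - w / 2) :=
    mul_le_mul_of_nonneg_left (by linarith) ha0
  have hNe : 0 ≤ e * N := by positivity
  have s4 : a * (2 * R * (e * N + T)) ≤ 2 * ε * (e * N + T) := by
    have h1 : a * (2 * R * (e * N + T)) ≤ γ * (2 * R * (e * N + T)) :=
      mul_le_mul_of_nonneg_right haγ (by positivity)
    have h2 : γ * R * (2 * (e * N + T)) ≤ ε * (2 * (e * N + T)) :=
      mul_le_mul_of_nonneg_right hγR (by positivity)
    linarith
  have s5 : a * (N / 2 * D) ≤ γ * (N / 2 * D) := mul_le_mul_of_nonneg_right haγ (by positivity)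
  have s6 : a * (w / 2) ≤ ε * (e * N) :=
    (mul_le_mul_of_nonneg_right haγ (by positivity)).trans hself
  have s7 : a * Q = γ * Q - γ * θ * Q := by rw [ha]; ring
  have s8 : (1 - 3 * ε) * (N * (e + γ / 2 * D)) ≤ (1 - 3 * ε) * (T + W + γ * Q) :=
    mul_le_mul_of_nonneg_left hmf (by linarith)
  have s9 : ε * N * (γ / 2 * D) ≤ ε * N * e := mul_le_mul_of_nonneg_left hDe (by positivity)
  have s10 : 0 ≤ ε * W := by positivity
  nlinarith

/-- The choice of the fraction `θ` of the interaction that is lost in the regularization, in the two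
regimes `γ ≥ 1`, where `θ = ε / 2`, and `γ ≤ 1`, where `γ θ = ε / 2`. -/
theorem exists_regularization_loss {N γ e Q r : ℝ} (hN : 0 < N) (hγ : 0 ≤ γ) (he : 1 / 4 ≤ e)
    (hγe : γ ≤ 2 * e) (hr0 : 0 < r) (hr1 : r ≤ 1) (hr3 : N * r ^ 3 = 1) (hQ0 : 0 ≤ Q)
    (hQ : Q ≤ 4 * e * N) (hsmall : 3 * (r * min (Real.sqrt γ) γ) ≤ 1) :
    ∃ θ, 0 ≤ θ ∧ θ ≤ 1 ∧ γ * r ^ 2 = 2 * (r * min (Real.sqrt γ) γ) * θ ∧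
      γ * r ^ 2 ≤ r * min (Real.sqrt γ) γ ∧
      γ * θ * Q ≤ 3 * (r * min (Real.sqrt γ) γ) * (γ * Q)
        + 2 * (r * min (Real.sqrt γ) γ) * (e * N) ∧
      γ * ((2 * r ^ 2)⁻¹ / 2) ≤ r * min (Real.sqrt γ) γ * (e * N) := by
  obtain ⟨s, hs⟩ : ∃ s, s = Real.sqrt γ := ⟨_, rfl⟩
  have hss : s * s = γ := by rw [hs]; exact Real.mul_self_sqrt hγ
  have hs0 : 0 ≤ s := by rw [hs]; exact Real.sqrt_nonneg _
  rw [← hs] at hsmall ⊢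
  have hself : (2 * r ^ 2)⁻¹ / 2 = N * r / 4 := by field_simp; linarith
  have he0 : 0 < e := by linarith
  rw [hself]
  have hγQ : 0 ≤ γ * Q := mul_nonneg hγ hQ0
  have heN : 0 ≤ e * N := by positivity
  have hrN : 0 ≤ r * N := by positivity
  rcases le_total 1 s with h1 | h1
  · have hmin : min s γ = s := min_eq_left (by nlinarith)
    rw [hmin] at hsmall ⊢
    have hrs : 0 ≤ r * s := by positivity
    refine ⟨r * s / 2, by positivity, by linarith, by rw [← hss]; ring, ?_, ?_, ?_⟩
    · rw [← hss]; nlinarith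
    · have h3 := mul_nonneg hrs hγQ
      have h4 := mul_nonneg hrs heN
      linarith
    · have h3 : γ / 4 ≤ s * e := by nlinarith
      have := mul_le_mul_of_nonneg_left h3 hrN
      linarith
  · have hmin : min s γ = γ := min_eq_right (by nlinarith)
    rw [hmin] at hsmall ⊢
    have hrγ : 0 ≤ r * γ := by positivity
    refine ⟨r / 2, by positivity, by linarith, by ring, ?_, ?_, ?_⟩
    · nlinarith
    · have h3 := mul_nonneg hrγ hγQ
      have h4 := mul_le_mul_of_nonneg_left hQ hrγ
      linarith
    · have h3 : γ * (1 / 4) ≤ γ * e := mul_le_mul_of_nonneg_left he hγ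
      have := mul_le_mul_of_nonneg_left h3 hrN
      linarith

/-- The lower bound in every bosonic state. The range of the regularization is `N ^ (-2/3)` and the
fraction of the kinetic energy used for it is `ε = N ^ (-1/3) min {√γ, γ}`. -/
theorem IsBosonicAdmissible.energy_lower_bound {N : ℕ} (hN : 1 ≤ N) {V : Potential} {γ : ℝ}
    (hγ : 0 ≤ γ) {ψ dψ : ℝ → ℂ} (hψ : IsAdmissible V ψ dψ)
    (hmin : ∀ φ dφ : ℝ → ℂ, IsAdmissible V φ dφ →
      gpFunctional V γ ψ dψ ≤ gpFunctional V γ φ dφ)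
    {Ψ : (Fin N → ℝ) → ℂ} {G : Fin N → (Fin N → ℝ) → ℂ} (h : IsBosonicAdmissible V Ψ G) :
    N * gpFunctional V γ ψ dψ * (1 - 11 * ((N : ℝ) ^ (-(1 / 3) : ℝ) * min (Real.sqrt γ) γ))
      ≤ manyBodyForm V γ G := by
  have hN0 : (0 : ℝ) < N := by exact_mod_cast hN
  have hN1 : (1 : ℝ) ≤ N := by exact_mod_cast hN
  set r := (N : ℝ) ^ (-(1 / 3) : ℝ) with hr
  have hr0 : 0 < r := Real.rpow_pos_of_pos hN0 _
  have hr1 : r ≤ 1 := Real.rpow_le_one_of_one_le_of_nonpos hN1 (by norm_num)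
  have hr3 : N * r ^ 3 = 1 := by
    rw [hr, ← Real.rpow_natCast, ← Real.rpow_mul hN0.le]
    norm_num
    rw [Real.rpow_neg_one]
    exact mul_inv_cancel₀ hN0.ne'
  set e := gpFunctional V γ ψ dψ
  have he4 : 1 / 4 ≤ e := hψ.one_fourth_le hγ
  have he0 : 0 < e := by linarith
  set ε := r * min (Real.sqrt γ) γ
  have hε0 : 0 ≤ ε := mul_nonneg hr0.le (le_min (Real.sqrt_nonneg _) hγ)
  -- for `ε > 1/3` the left-hand side is negative
  rcases lt_or_ge 1 (3 * ε) with hbig | hsmall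
  · refine le_trans ?_ (manyBodyForm_nonneg V hγ G)
    exact mul_nonpos_of_nonneg_of_nonpos (by positivity) (by linarith)
  set R := r ^ 2
  have hR0 : 0 < R := by positivity
  set D := ∫ x, ‖ψ x‖ ^ 4 ∂unitMeasure
  have hD1 : 1 ≤ D := hψ.one_le_integral_pow_four
  have hDe : γ / 2 * D ≤ e := interaction_le_gpFunctional
  have hγe : γ ≤ 2 * e := by
    have := mul_le_mul_of_nonneg_left hD1 (by positivity : 0 ≤ γ / 2)
    linarith
  set ρ : ℝ → ℝ := fun x => ‖ψ x‖ ^ 2 with hρ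
  have hρc : ContinuousOn ρ (Icc 0 1) := hψ.isH01.continuousOn.norm.pow 2
  have hρi : Integrable ρ unitMeasure := hψ.isH01.integrable_normSq
  have hρ2 : (fun x => ρ x ^ 2) = fun x => ‖ψ x‖ ^ 4 := by
    funext x; simp only [hρ]; ring
  have hM : ∀ x ∈ Icc (0 : ℝ) 1, ρ x ≤ 2 * Real.sqrt e := fun x hx => hψ.normSq_le hγ hx
  have hse : 0 < Real.sqrt e := Real.sqrt_pos.2 he0
  have hse2 : Real.sqrt e * Real.sqrt e = e := Real.mul_self_sqrt he0.le
  have hseh : 1 / 2 ≤ Real.sqrt e := Real.le_sqrt_of_sq_le (by linarith)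
  set T := ∑ i, ∫ z, ‖G i z‖ ^ 2 ∂cube N with hT
  set W := ∑ i, ∫ p : (Fin N → ℝ) × ℝ, ‖lineValue G i p.1 p.2‖ ^ 2 ∂((cube N).prod V.measure)
  set J := ∑ i, ∑ j ∈ Finset.Ioi i, ∫ z, ‖lineValue G i z (z j)‖ ^ 2 ∂cube N
  set S := ∑ i, ∑ j ∈ Finset.Ioi i, ∫ z, expKernel R (z i) (z j) * ‖Ψ z‖ ^ 2 ∂cube N
  set P := ∑ i, ∫ z, expConv R ρ (z i) * ‖Ψ z‖ ^ 2 ∂cube N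
  set Q := ∑ i, ∫ z, ρ (z i) * ‖Ψ z‖ ^ 2 ∂cube N
  have hA : manyBodyForm V γ G = T + W + γ / N * J := by
    rw [manyBodyForm, Finset.sum_add_distrib]
  have hTi : ∀ i, 0 ≤ ∫ z, ‖G i z‖ ^ 2 ∂cube N := fun i => integral_nonneg fun _ => by positivity
  have hT0 : 0 ≤ T := Finset.sum_nonneg fun i _ => hTi i
  have hW0 : 0 ≤ W := Finset.sum_nonneg fun i _ => integral_nonneg fun _ => by positivity
  have hQ0 : 0 ≤ Q := Finset.sum_nonneg fun i _ => integral_nonneg fun _ => by positivity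
  have hsum : ∀ c : ℝ, ∑ _ : Fin N, c = N * c := fun c => by simp
  have hQle : Q ≤ 4 * e * N := by
    have h1 : ∀ i, ∫ z, ρ (z i) * ‖Ψ z‖ ^ 2 ∂cube N ≤ 2 * Real.sqrt e := by
      intro i
      have hC : ∀ᵐ z ∂cube N, |ρ (z i)| ≤ 2 * Real.sqrt e := by
        filter_upwards [ae_cube_mem_Icc N] with z hz
        rw [abs_of_nonneg (by positivity)]; exact hM _ (hz i)
      have := integral_mono_ae (h.integrable_weight (aestronglyMeasurable_comp_eval hρi.1 i) hC)
        (h.integrable_normSq.const_mul (2 * Real.sqrt e)) (by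
          filter_upwards [hC] with z hz
          exact mul_le_mul_of_nonneg_right ((le_abs_self _).trans hz) (by positivity))
      rwa [integral_const_mul, h.normalized, mul_one] at this
    have h2 := Finset.sum_le_sum fun i (_ : i ∈ (Finset.univ : Finset (Fin N))) => h1 i
    rw [hsum] at h2
    refine h2.trans ?_
    -- `√e ≤ 2 e`, because `e ≥ 1/4`
    nlinarith
  obtain ⟨θ, hθ0, hθ1, hrel, hγR, hQloss, hself⟩ := exists_regularization_loss hN0 hγ he4 hγe hr0 hr1
    hr3 hQ0 hQle hsmall
  have hpair : γ * (1 - θ) * ((2 * R)⁻¹ * S) ≤ γ * J + ε * (N * T) := by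
    have h1 : ∑ i, ∑ j ∈ Finset.Ioi i, γ * (1 - θ) * ((2 * R)⁻¹
          * ∫ z, expKernel R (z i) (z j) * ‖Ψ z‖ ^ 2 ∂cube N)
        ≤ ∑ i, ∑ j ∈ Finset.Ioi i, (γ * (∫ z, ‖lineValue G i z (z j)‖ ^ 2 ∂cube N)
          + ε * ∫ z, ‖G i z‖ ^ 2 ∂cube N) :=
      Finset.sum_le_sum fun i _ => Finset.sum_le_sum fun j hj =>
        h.regularized_pair_le (Finset.mem_Ioi.1 hj).ne hR0 hγ hε0 hrel
    simp only [Finset.sum_add_distrib, ← Finset.mul_sum, Finset.sum_const, nsmul_eq_mul] at h1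
    refine h1.trans ?_
    gcongr
    rw [hT, Finset.mul_sum]
    refine Finset.sum_le_sum fun i _ => ?_
    have hc : ((Finset.Ioi i).card : ℝ) ≤ N := by
      exact_mod_cast (Finset.card_le_univ _).trans_eq (Fintype.card_fin N)
    exact mul_le_mul_of_nonneg_right hc (hTi i)
  have hsmear : Q ≤ (2 * R)⁻¹ * P + 2 * R * (e * N + T) := by
    have h1 := Finset.sum_le_sum fun i (_ : i ∈ (Finset.univ : Finset (Fin N))) =>
      h.integral_density_le i hR0 hρc (fun x _ => by positivity) hM hse
    simp only [Finset.sum_add_distrib, ← Finset.mul_sum, hsum] at h1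
    have h2 : ∀ X, R * (2 * Real.sqrt e) * (N * Real.sqrt e + (Real.sqrt e)⁻¹ * X)
        = 2 * R * (e * N + X) := fun X => by
      have h3 : Real.sqrt e * (Real.sqrt e)⁻¹ = 1 := mul_inv_cancel₀ hse.ne'
      linear_combination 2 * R * N * hse2 + 2 * R * X * h3
    rw [h2] at h1
    exact h1
  have hmf : N * (e + γ / 2 * D) ≤ T + W + γ * Q := by
    have h1 := Finset.sum_le_sum fun i (_ : i ∈ (Finset.univ : Finset (Fin N))) =>
      h.meanField_lower_bound i hγ hψ hmin hM
    simpa only [Finset.sum_add_distrib, ← Finset.mul_sum, hsum] using h1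
  have hyoung : ∫ x, ρ x * expConv R ρ x ∂unitMeasure ≤ 2 * R * D := by
    have := integral_mul_expConv_self_le hR0 hρi (by rw [hρ2]; exact hψ.isH01.integrable_pow_four)
    rwa [hρ2] at this
  rw [hA]
  exact lower_bound_arithmetic hN0 hγ he0.le hT0 hW0 (by linarith) hε0 hsmall hθ0 hθ1 hR0 hpair
    (h.sum_regularized_lower_bound hR0 hρi) hyoung hsmear hmf hDe hγR hQloss hself

theorem gpFunctional_eq_gpEnergy {V : Potential} {γ : ℝ} {ψ dψ : ℝ → ℂ} (hψ : IsAdmissible V ψ dψ)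
    (hmin : ∀ φ dφ : ℝ → ℂ, IsAdmissible V φ dφ →
      gpFunctional V γ ψ dψ ≤ gpFunctional V γ φ dφ) : gpEnergy V γ = gpFunctional V γ ψ dψ :=
  IsLeast.csInf_eq ⟨⟨ψ, dψ, hψ, rfl⟩, by rintro _ ⟨φ, dφ, h, rfl⟩; exact hmin φ dφ h⟩

/-- The Gross-Pitaevskii energy is the ground state energy of the mean-field Hamiltonian of any
minimizer, which is its ground state. -/
theorem meanFieldEnergy_eq_gpEnergy {V : Potential} {γ : ℝ} {ψ₀ : ℝ → ℝ}
    (h : IsGPMinimizer V γ ψ₀) : meanFieldEnergy V γ ψ₀ = gpEnergy V γ := by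
  obtain ⟨-, dψ, hψ, hmin⟩ := h
  have e2 : ∀ x, ψ₀ x ^ 2 = ‖(ψ₀ x : ℂ)‖ ^ 2 := fun x => by simp
  have e4 : ∀ x, ψ₀ x ^ 4 = ‖(ψ₀ x : ℂ)‖ ^ 4 := fun x => by
    rw [show (4 : ℕ) = 2 * 2 from rfl, pow_mul, pow_mul, e2]
  rw [gpFunctional_eq_gpEnergy hψ hmin]
  refine IsLeast.csInf_eq ⟨⟨_, dψ, hψ, ?_⟩, ?_⟩
  · unfold meanFieldForm gpFunctional
    rw [hψ.normalized]
    have e : ∀ x, ψ₀ x ^ 2 * ‖(ψ₀ x : ℂ)‖ ^ 2 = ‖(ψ₀ x : ℂ)‖ ^ 4 := fun x => by rw [e2]; ring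
    simp only [e, e4]
    ring
  · rintro _ ⟨φ, dφ, hφ, rfl⟩
    have h1 := meanField_lower_bound_of_minimizer V hψ hφ hmin
    unfold meanFieldForm
    rw [hφ.normalized]
    simp only [e2, e4]
    linarith

theorem exists_isBosonicAdmissible (N : ℕ) (V : Potential) :
    ∃ (Ψ : (Fin N → ℝ) → ℂ) (G : Fin N → (Fin N → ℝ) → ℂ), IsBosonicAdmissible V Ψ G := by
  obtain ⟨ψ, dψ, h⟩ := exists_isAdmissible V
  exact ⟨_, _, isBosonicAdmissible_productState h⟩

end LiebLiniger

theorem theorem2p1 :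
    ∃ C : ℝ, 0 < C ∧ ∀ (V : LiebLiniger.Potential) (γ : ℝ), 0 ≤ γ →
      (∃ ψ₀ : ℝ → ℝ, LiebLiniger.IsGPMinimizer V γ ψ₀) ∧
      ∀ ψ₀ : ℝ → ℝ, LiebLiniger.IsGPMinimizer V γ ψ₀ →
        LiebLiniger.meanFieldEnergy V γ ψ₀ = LiebLiniger.gpEnergy V γ ∧
        ∀ N : ℕ, 1 ≤ N →
          LiebLiniger.groundStateEnergy N V γ / N ≤ LiebLiniger.meanFieldEnergy V γ ψ₀ ∧
          LiebLiniger.meanFieldEnergy V γ ψ₀ *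
              (1 - C * (N : ℝ) ^ (-(1 / 3) : ℝ) * min (Real.sqrt γ) γ)
            ≤ LiebLiniger.groundStateEnergy N V γ / N := by
  refine ⟨11, by norm_num, fun V γ hγ => ⟨LiebLiniger.exists_isGPMinimizer V hγ, fun ψ₀ h => ?_⟩⟩
  have hmf := LiebLiniger.meanFieldEnergy_eq_gpEnergy h
  refine ⟨hmf, fun N hN => ?_⟩
  obtain ⟨-, dψ, hψ, hmin⟩ := h
  have hN0 : (0 : ℝ) < N := by exact_mod_cast hN
  rw [hmf, LiebLiniger.gpFunctional_eq_gpEnergy hψ hmin]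
  constructor
  · rw [div_le_iff₀ hN0, mul_comm]
    exact LiebLiniger.groundStateEnergy_le N V hγ hψ
  · rw [le_div_iff₀ hN0]
    obtain ⟨Ψ, G, hΨ⟩ := LiebLiniger.exists_isBosonicAdmissible N V
    refine le_csInf ⟨_, Ψ, G, hΨ, rfl⟩ ?_
    rintro _ ⟨Ψ, G, hΨ, rfl⟩
    refine le_trans (le_of_eq ?_) (hΨ.energy_lower_bound hN hγ hψ hmin)
    ring
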